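/- Setting. Let $n\ge 2$, $m\ge 1$, $1\le k\le d$. Let $p^l\in\Delta^n$ and $x^l_1,\dots,x^l_n\in\mathbb R^d$ for $l\in[m]$ (so $\mu^l=\sum_i p^l_i\delta_{x^l_i}$), let $y_1,\dots,y_n\in\mathbb R^d$ be the fixed support of the barycenter, and $\omega\in\Delta^m$. Put $\bar c=\max_{l,i,j}\|x^l_i-y_j\|^2$ and assume $\bar c>0$. Let $\mathrm{St}(d,k)=\{U\in\mathbb R^{d\times k}: U^\top U=I_k\}$, let $T_U$ be its tangent space at $U$ and $\mathrm{Proj}_{T_U}$ the Frobenius-orthogonal projection onto $T_U$. For $\pi=(\pi^l)_{l\in[m]}$, $\pi^l\in\mathbb R^{n\times n}$, let $$f(\pi,U)=\sum_l\omega^l\sum_{i,j}\pi^l_{ij}\|U^\top(x^l_i-y_j)\|^2,\qquad V_\pi=\sum_l\omega^l\sum_{i,j}\pi^l_{ij}(x^l_i-y_j)(x^l_i-y_j)^\top,$$ and let $\Pi(p)$ be the set of $\pi$ with $\pi^l\ge 0$, $\pi^l\mathbf 1=p^l$ for all $l$, and $(\pi^l)^\top\mathbf 1$ independent of $l$. The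 RPRWB problem is $\max_{U\in\mathrm{St}(d,k)}\min_{\pi\in\Pi(p)}f(\pi,U)$. A pair $(\hat\pi,\hat U)\in\Pi(p)\times\mathrm{St}(d,k)$ is an $\epsilon$-stationary point if $\|\mathrm{grad}_Uf(\hat\pi,\hat U)\|_F\le\epsilon$, where $\mathrm{grad}_U f=\mathrm{Proj}_{T_U}(\nabla_U f)$, and $f(\hat\pi,\hat U)-f(\pi^*,\hat U)\le\epsilon$ for a minimizer $\pi^*$ of $f(\cdot,\hat U)$ over $\Pi(p)$. Let $\mathrm{Retr}$ be a retraction on $\mathrm{St}(d,k)$, i.e. a smooth map from the tangent bundle to $\mathrm{St}(d,k)$ with $\mathrm{Retr}_U(0)=U$ and $\|\mathrm{Retr}_U(\xi)-(U+\xi)\|_F/\|\xi\|_F\to0$ as $0\neq\xi\to0$ in $T_U$. The constants $L_1,L_2>0$ are such that $\|\mathrm{Retr}_U(\xi)-U\|_F\le L_1\|\xi\|_F$ and $\|\mathrm{Retr}_U(\xi)-(U+\xi)\|_F\le L_2\|\xi\|_F^2$ for all $U\in\mathrm{St}(d,k)$, $\xi\in T_U$. IBP solver, with input $U\in\mathrm{St}(d,k)$,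 $\eta,\epsilon>0$ and an initial pair $(u_0,v_0)\in(\mathbb R^{m\times n})^2$ with $\sum_l\omega^lv^l_0=0$. Write $\pi(u,v)^l_{ij}=\exp(-\|U^\top(x^l_i-y_j)\|^2/\eta+u^l_i+v^l_j)$ (with $u^l_i=-\infty$, i.e. row $i$ of $\pi(u,v)^l$ equal to $0$, if $p^l_i=0$). For $s=0,1,2,\dots$: first $v^l_{s+1}=v^l_s+\log(q/q^l)$ with $q^l=(\pi(u_s,v_s)^l)^\top\mathbf 1$ and $q=\exp(\sum_l\omega^l\log q^l)$; then $u^l_{s+1}=u^l_s+\log\bigl(p^l/(\pi(u_s,v_{s+1})^l\mathbf 1)\bigr)$; with $q^l_s=(\pi(u_{s+1},v_{s+1})^l)^\top\mathbf 1$ and $\bar q_s=\sum_l\omega^lq^l_s$, stop as soon as $\sum_l\omega^l\|q^l_s-\bar q_s\|_1\le\eta\epsilon^2/(200\bar c^3)$, and return $\bigl(\mathrm{Round}(\pi(u_{s+1},v_{s+1})^l,p^l,\bar q_s)\bigr)_l$. Here $\mathrm{Round}(\pi,p,q)$ first multiplies each row $i$ of $\pi$ by $\min(p_i/(\pi\mathbf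 1)_i,1)$, then each column $j$ of the resulting matrix $\pi'$ by $\min(q_j/((\pi')^\top\mathbf 1)_j,1)$, giving $\pi''$, and returns $\pi''+e_pe_q^\top/\|e_p\|_1$ with $e_p=p-\pi''\mathbf 1$, $e_q=q-(\pi'')^\top\mathbf 1$ (and $\pi''$ if $e_p=0$). RGA-IBP, started at an arbitrary $U_0\in\mathrm{St}(d,k)$. For $t=0,1,2,\dots$: let $\pi_{t+1}$ be the output of the IBP solver at $U_t$ (from any admissible initial pair, which may depend on $t$), $\xi_{t+1}=\mathrm{Proj}_{T_{U_t}}(2V_{\pi_{t+1}}U_t)$ and $U_{t+1}=\mathrm{Retr}_{U_t}(\tau\xi_{t+1})$; at the first $t=T$ with $\|\xi_{t+1}\|_F\le\epsilon$, break and return $\hat\pi=\pi_{T+1}$, $\hat U=U_T$. Theorem. Every retraction on $\mathrm{St}(d,k)$ has constants $L_1,L_2$ as above. For all such constants and all $\epsilon>0$, take $$\tau=\frac1{8L_2\bar c+2\rho L_1^2},\qquad \eta=\frac{\epsilon}{4\log n+2},\qquad \rho=2\bar c+\frac{4\bar c^2}{\eta}.$$ Then all calls of the IBP solver that RGA-IBP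 makes terminate, RGA-IBP breaks at some finite $T$, its output $(\hat\pi,\hat U)$ is an $\epsilon$-stationary point of the RPRWB problem, and $$T=O\bigl(\log(n)^2L_1^2\,\bar c^4\,k\,\epsilon^{-4}\bigr).$$ Precisely, there is an absolute constant $C>0$ such that always $T\le C\,(1+L_2)\log(n)^2L_1^2\bar c^4k\,\epsilon^{-4}$, and $T\le C\log(n)^2L_1^2\bar c^4k\,\epsilon^{-4}$ whenever $L_2\epsilon\le L_1^2\bar c$ (in particular for all sufficiently small $\epsilon$). -/

import Mathlib

open scoped Matrix ContDiff Topology Matrix.Norms.Frobenius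

namespace RPRWB

/-! ### The Stiefel manifold, its tangent spaces, retractions -/

/-- The Frobenius inner product `⟨A, B⟩ = tr (Aᵀ B)`; its norm is the Frobenius norm. -/
noncomputable instance frobeniusInnerProductSpace (d k : ℕ) :
    InnerProductSpace ℝ (Matrix (Fin d) (Fin k) ℝ) where
  inner A B := (Aᵀ * B).trace
  norm_sq_eq_re_inner A := by
    have h : (Aᵀ * A).trace = ∑ i, ∑ j, A i j ^ 2 := by
      simp only [Matrix.trace, Matrix.diag_apply, Matrix.mul_apply, Matrix.transpose_apply]
      rw [Finset.sum_comm]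
      simp only [sq]
    have h0 : 0 ≤ ∑ i, ∑ j, A i j ^ 2 :=
      Finset.sum_nonneg fun i _ => Finset.sum_nonneg fun j _ => sq_nonneg _
    have hn : ‖A‖ = Real.sqrt (∑ i, ∑ j, A i j ^ 2) := by
      rw [Matrix.frobenius_norm_def, Real.sqrt_eq_rpow]
      simp
    rw [hn, Real.sq_sqrt h0, ← h]
    rfl
  conj_inner_symm A B := by
    change (Bᵀ * A).trace = (Aᵀ * B).trace
    rw [← Matrix.trace_transpose, Matrix.transpose_mul, Matrix.transpose_transpose]
  add_left A B C := by
    change ((A + B)ᵀ * C).trace = (Aᵀ * C).trace + (Bᵀ * C).trace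
    rw [Matrix.transpose_add, Matrix.add_mul, Matrix.trace_add]
  smul_left A B r := by
    change ((r • A)ᵀ * B).trace = r * (Aᵀ * B).trace
    rw [Matrix.transpose_smul, Matrix.smul_mul, Matrix.trace_smul, smul_eq_mul]

/-- The Stiefel manifold `St(d, k) = {U ∈ ℝ^{d × k} | Uᵀ U = I}`. -/
def stiefel (d k : ℕ) : Set (Matrix (Fin d) (Fin k) ℝ) := {U | Uᵀ * U = 1}

/-- The tangent space `T_U St(d, k) = {ξ | Uᵀ ξ + ξᵀ U = 0}`. -/
def tangentSpace {d k : ℕ} (U : Matrix (Fin d) (Fin k) ℝ) :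
    Submodule ℝ (Matrix (Fin d) (Fin k) ℝ) where
  carrier := {ξ | Uᵀ * ξ + ξᵀ * U = 0}
  zero_mem' := by simp
  add_mem' {ξ ζ} hξ hζ := by
    simp only [Set.mem_ofPred_eq] at *
    rw [Matrix.mul_add, Matrix.transpose_add, Matrix.add_mul, add_add_add_comm, hξ, hζ, add_zero]
  smul_mem' r ξ hξ := by
    simp only [Set.mem_ofPred_eq] at *
    rw [Matrix.mul_smul, Matrix.transpose_smul, Matrix.smul_mul, ← smul_add, hξ, smul_zero]

/-- The orthogonal projection (for the Frobenius inner product) onto `T_U St(d, k)`. -/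
noncomputable def tangentProj {d k : ℕ} (U G : Matrix (Fin d) (Fin k) ℝ) :
    Matrix (Fin d) (Fin k) ℝ :=
  (tangentSpace U).starProjection G

/-- The Riemannian gradient on the Stiefel manifold: the tangential projection of the Euclidean
gradient. -/
noncomputable def riemannianGrad {d k : ℕ} (F : Matrix (Fin d) (Fin k) ℝ → ℝ)
    (U : Matrix (Fin d) (Fin k) ℝ) : Matrix (Fin d) (Fin k) ℝ :=
  tangentProj U (gradient F U)

/-- `Retr` is a retraction on `St(d, k)`. Only the values `Retr U ξ` with `U ∈ St(d, k)` and
`ξ ∈ T_U St(d, k)` matter. The tangent bundle is a closed embedded submanifold of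
`ℝ^{d × k} × ℝ^{d × k}`, so that a map on it is smooth iff it has a smooth extension. -/
structure IsRetraction {d k : ℕ}
    (Retr : Matrix (Fin d) (Fin k) ℝ → Matrix (Fin d) (Fin k) ℝ → Matrix (Fin d) (Fin k) ℝ) :
    Prop where
  mapsTo : ∀ U ∈ stiefel d k, ∀ ξ ∈ tangentSpace U, Retr U ξ ∈ stiefel d k
  smooth : ∃ F : Matrix (Fin d) (Fin k) ℝ × Matrix (Fin d) (Fin k) ℝ → Matrix (Fin d) (Fin k) ℝ,
    ContDiff ℝ ∞ F ∧ ∀ U ∈ stiefel d k, ∀ ξ ∈ tangentSpace U, F (U, ξ) = Retr U ξ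
  zero : ∀ U ∈ stiefel d k, Retr U 0 = U
  first_order : ∀ U ∈ stiefel d k,
    Filter.Tendsto (fun ξ => ‖Retr U ξ - (U + ξ)‖ / ‖ξ‖)
      (𝓝[(tangentSpace U : Set (Matrix (Fin d) (Fin k) ℝ)) \ {0}] 0) (𝓝 0)

/-- `L₁, L₂ > 0` are first and second order constants of the retraction. -/
structure IsRetractionConst {d k : ℕ}
    (Retr : Matrix (Fin d) (Fin k) ℝ → Matrix (Fin d) (Fin k) ℝ → Matrix (Fin d) (Fin k) ℝ)
    (L₁ L₂ : ℝ) : Prop where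
  pos₁ : 0 < L₁
  pos₂ : 0 < L₂
  bound₁ : ∀ U ∈ stiefel d k, ∀ ξ ∈ tangentSpace U, ‖Retr U ξ - U‖ ≤ L₁ * ‖ξ‖
  bound₂ : ∀ U ∈ stiefel d k, ∀ ξ ∈ tangentSpace U, ‖Retr U ξ - (U + ξ)‖ ≤ L₂ * ‖ξ‖ ^ 2

/-! ### The fixed-support RPRWB problem -/

/-- The data: `m` discrete measures `μ^l = ∑ i, p l i • δ_{x l i}` supported on `n` points in
`ℝ^d`, the fixed support `y` of the barycenter, and the weights `w`. -/
structure Data (m n d : ℕ) where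
  x : Fin m → Fin n → EuclideanSpace ℝ (Fin d)
  p : Fin m → Fin n → ℝ
  p_nonneg : ∀ l i, 0 ≤ p l i
  p_sum : ∀ l, ∑ i, p l i = 1
  y : Fin n → EuclideanSpace ℝ (Fin d)
  w : Fin m → ℝ
  w_nonneg : ∀ l, 0 ≤ w l
  w_sum : ∑ l, w l = 1

/-- A family `π = (π^l)_l` of `n × n` matrices. -/
abbrev Plan (m n : ℕ) := Fin m → Matrix (Fin n) (Fin n) ℝ

variable {m n d k : ℕ}

/-- `c̄ = max_l ‖C^l‖_∞`, where `C^l_{ij} = ‖x^l_i - y_j‖²`. -/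
noncomputable def cbar (D : Data m n d) : ℝ :=
  ⨆ t : Fin m × Fin n × Fin n, ‖D.x t.1 t.2.1 - D.y t.2.2‖ ^ 2

/-- The projected cost `‖Uᵀ (x^l_i - y_j)‖²` (Euclidean norm in `ℝ^k`). -/
noncomputable def projCost (D : Data m n d) (U : Matrix (Fin d) (Fin k) ℝ)
    (l : Fin m) (i j : Fin n) : ℝ :=
  ‖WithLp.toLp 2 (Uᵀ *ᵥ (D.x l i - D.y j).ofLp)‖ ^ 2

/-- The objective `f(π, U) = ∑ l, w l * ∑ i j, π^l_{ij} ‖Uᵀ (x^l_i - y_j)‖²`. -/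
noncomputable def objective (D : Data m n d) (π : Plan m n) (U : Matrix (Fin d) (Fin k) ℝ) : ℝ :=
  ∑ l, D.w l * ∑ i, ∑ j, π l i j * projCost D U l i j

/-- `Π(p)`: nonnegative, row sums `p^l`, and a column sum that does not depend on `l`. -/
def feasible (D : Data m n d) : Set (Plan m n) :=
  {π | (∀ l i j, 0 ≤ π l i j) ∧ (∀ l i, ∑ j, π l i j = D.p l i) ∧
    ∀ l l' j, ∑ i, π l i j = ∑ i, π l' i j}

/-- `ε`-stationary points of `max_{U ∈ St(d,k)} min_{π ∈ Π(p)} f(π, U)`. -/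
def IsStationary (D : Data m n d) (ε : ℝ) (π : Plan m n) (U : Matrix (Fin d) (Fin k) ℝ) : Prop :=
  π ∈ feasible D ∧ U ∈ stiefel d k ∧
  ‖riemannianGrad (fun W => objective D π W) U‖ ≤ ε ∧
  ∃ πs ∈ feasible D, IsMinOn (fun π' => objective D π' U) (feasible D) πs ∧
    objective D π U - objective D πs U ≤ ε

/-- The correlation matrix `V_π`. -/
noncomputable def corr (D : Data m n d) (π : Plan m n) : Matrix (Fin d) (Fin d) ℝ :=
  ∑ l, D.w l • ∑ i, ∑ j,
    π l i j • Matrix.vecMulVec (D.x l i - D.y j).ofLp (D.x l i - D.y j).ofLp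

/-! ### The rounding procedure -/

/-- `Round(π, p, q)`. When `err_p = 0` the correction is `0` (division by zero). -/
noncomputable def roundPlan (π : Matrix (Fin n) (Fin n) ℝ) (p q : Fin n → ℝ) :
    Matrix (Fin n) (Fin n) ℝ :=
  let X : Matrix (Fin n) (Fin n) ℝ := Matrix.diagonal fun i => min (p i / ∑ j, π i j) 1
  let π₁ := X * π
  let Y : Matrix (Fin n) (Fin n) ℝ := Matrix.diagonal fun j => min (q j / ∑ i, π₁ i j) 1
  let π₂ := π₁ * Y
  let errp : Fin n → ℝ := fun i => p i - ∑ j, π₂ i j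
  let errq : Fin n → ℝ := fun j => q j - ∑ i, π₂ i j
  Matrix.of fun i j => π₂ i j + errp i * errq j / ∑ i', |errp i'|

/-! ### The IBP solver -/

open Classical in
/-- `π(u, v, U)^l_{ij} = exp (-‖Uᵀ (x^l_i - y_j)‖² / η + u^l_i + v^l_j)`. If `p^l_i = 0`, then
`u^l_i = log (p^l_i / …)` stands for `-∞`, and the row is `0`. -/
noncomputable def gibbs (D : Data m n d) (U : Matrix (Fin d) (Fin k) ℝ) (η : ℝ)
    (u v : Fin m → Fin n → ℝ) : Plan m n :=
  fun l => Matrix.of fun i j =>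
    if D.p l i = 0 then 0 else Real.exp (-projCost D U l i j / η + u l i + v l j)

/-- The column sums `(π^l)ᵀ 1`. -/
def colSum (π : Plan m n) (l : Fin m) (j : Fin n) : ℝ := ∑ i, π l i j

/-- The update `v^l ← v^l + log (q / q^l)`, where `q^l` are the column sums of `π(u, v, U)` and
`q = exp (∑ l, w l * log q^l)` is their geometric mean. -/
noncomputable def updateV (D : Data m n d) (U : Matrix (Fin d) (Fin k) ℝ) (η : ℝ)
    (u v : Fin m → Fin n → ℝ) : Fin m → Fin n → ℝ := fun l j =>
  v l j + Real.log (Real.exp (∑ l', D.w l' * Real.log (colSum (gibbs D U η u v) l' j)) /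
    colSum (gibbs D U η u v) l j)

/-- The update `u^l ← u^l + log (p^l / (π(u, v, U) 1))` (the entries with `p^l_i = 0` are not
used, see `gibbs`). -/
noncomputable def updateU (D : Data m n d) (U : Matrix (Fin d) (Fin k) ℝ) (η : ℝ)
    (u v : Fin m → Fin n → ℝ) : Fin m → Fin n → ℝ := fun l i =>
  u l i + Real.log (D.p l i / ∑ j, gibbs D U η u v l i j)

/-- The iterates `(u_s, v_s)` of IBP, started at `init = (u_0, v_0)`: first `v`, then `u`. -/
noncomputable def ibpIter (D : Data m n d) (U : Matrix (Fin d) (Fin k) ℝ) (η : ℝ)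
    (init : (Fin m → Fin n → ℝ) × (Fin m → Fin n → ℝ)) :
    ℕ → (Fin m → Fin n → ℝ) × (Fin m → Fin n → ℝ)
  | 0 => init
  | s + 1 =>
    let uv := ibpIter D U η init s
    let v := updateV D U η uv.1 uv.2
    (updateU D U η uv.1 v, v)

/-- `π(u_{s+1}, v_{s+1}, U)`, computed in iteration `s`. -/
noncomputable def ibpPlan (D : Data m n d) (U : Matrix (Fin d) (Fin k) ℝ) (η : ℝ)
    (init : (Fin m → Fin n → ℝ) × (Fin m → Fin n → ℝ)) (s : ℕ) : Plan m n :=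
  gibbs D U η (ibpIter D U η init (s + 1)).1 (ibpIter D U η init (s + 1)).2

/-- `q̄_s = ∑ l, w l * q^l_s`, where `q^l_s` are the column sums of `ibpPlan … s`. -/
noncomputable def ibpMean (D : Data m n d) (U : Matrix (Fin d) (Fin k) ℝ) (η : ℝ)
    (init : (Fin m → Fin n → ℝ) × (Fin m → Fin n → ℝ)) (s : ℕ) (j : Fin n) : ℝ :=
  ∑ l, D.w l * colSum (ibpPlan D U η init s) l j

/-- The stopping test of IBP in iteration `s`. -/
def ibpTest (D : Data m n d) (U : Matrix (Fin d) (Fin k) ℝ) (η ε : ℝ)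
    (init : (Fin m → Fin n → ℝ) × (Fin m → Fin n → ℝ)) (s : ℕ) : Prop :=
  ∑ l, D.w l * ∑ j, |colSum (ibpPlan D U η init s) l j - ibpMean D U η init s j| ≤
    η * ε ^ 2 / (200 * cbar D ^ 3)

open Classical in
/-- `IBPsolver(μ, Y, U, η, ε)`: stop at the first iteration that passes the test and round the
plan found there; `none` if the test is never passed. -/
noncomputable def ibpSolver (D : Data m n d) (U : Matrix (Fin d) (Fin k) ℝ) (η ε : ℝ)
    (init : (Fin m → Fin n → ℝ) × (Fin m → Fin n → ℝ)) : Option (Plan m n) :=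
  if h : ∃ s, ibpTest D U η ε init s then
    some fun l => roundPlan (ibpPlan D U η init (Nat.find h) l) (D.p l)
      (ibpMean D U η init (Nat.find h))
  else none

/-! ### Riemannian gradient ascent with the IBP solver -/

/-- The ascent direction `ξ = Proj_{T_U} (2 V_π U)`. -/
noncomputable def ascentDir (D : Data m n d) (π : Plan m n) (U : Matrix (Fin d) (Fin k) ℝ) :
    Matrix (Fin d) (Fin k) ℝ :=
  tangentProj U ((2 : ℝ) • (corr D π * U))

/-- The outer iterates `U_t` (with the break ignored): `π_{t+1}` is the output of the IBP solver at
`U_t`, started at `init t`, and `U_{t+1} = Retr_{U_t} (τ ξ_{t+1})`. The value is `none` if one of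
the previous calls of the solver does not terminate. -/
noncomputable def rgaIter (D : Data m n d)
    (Retr : Matrix (Fin d) (Fin k) ℝ → Matrix (Fin d) (Fin k) ℝ → Matrix (Fin d) (Fin k) ℝ)
    (τ η ε : ℝ) (init : ℕ → (Fin m → Fin n → ℝ) × (Fin m → Fin n → ℝ))
    (U₀ : Matrix (Fin d) (Fin k) ℝ) : ℕ → Option (Matrix (Fin d) (Fin k) ℝ)
  | 0 => some U₀
  | t + 1 =>
    (rgaIter D Retr τ η ε init U₀ t).bind fun U =>
      (ibpSolver D U η ε (init t)).map fun π => Retr U (τ • ascentDir D π U)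

/-- The algorithm breaks in iteration `T` (counted from `0`), the first one with
`‖ξ_{T+1}‖_F ≤ ε`, and returns `π = π_{T+1}` and `U = U_T`. -/
def RGAReturns (D : Data m n d)
    (Retr : Matrix (Fin d) (Fin k) ℝ → Matrix (Fin d) (Fin k) ℝ → Matrix (Fin d) (Fin k) ℝ)
    (τ η ε : ℝ) (init : ℕ → (Fin m → Fin n → ℝ) × (Fin m → Fin n → ℝ))
    (U₀ : Matrix (Fin d) (Fin k) ℝ)
    (T : ℕ) (π : Plan m n) (U : Matrix (Fin d) (Fin k) ℝ) : Prop :=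
  rgaIter D Retr τ η ε init U₀ T = some U ∧ ibpSolver D U η ε (init T) = some π ∧
  ‖ascentDir D π U‖ ≤ ε ∧
  ∀ t < T, ∀ U' π', rgaIter D Retr τ η ε init U₀ t = some U' →
    ibpSolver D U' η ε (init t) = some π' → ε < ‖ascentDir D π' U'‖

end RPRWB

/-!
Both loops of the algorithm are ascent methods for one function, the dual of the entropic problem:
IBP maximizes it over the potentials, and the Riemannian steps increase its optimal value as a
function of `U`.

Eliminating the row potentials `u`, the entropic problem at `U` has the semi-dual function
`-η * wlse (-C_U / η + v)`, where `C_U` are the projected costs and `wlse` is an average of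
log-sum-exp functions. The gradient of `wlse` is the plan `softPlan` whose rows are softmaxes, and
after each iteration of IBP the current plan is of this kind. The strong convexity inequality
`wlse_ge`, whose remainder is the squared `ℓ¹` distance of the plans, gives the monotonicity of the
gradient (`sq_wnorm_softPlan_sub_le`) and the smoothness in the sup norm (`wlse_le_add_sq`). Weak
duality (`wdot_le_wlse`) is tight up to an entropy of at most `log n` (`wlse_le_log_add`).

Termination of IBP: an iteration decreases `wlse` by at least a multiple of the square of the tested
quantity (`wlse_ibpIter_succ_le`), while `wlse` is bounded below. After one iteration the potentials
`v` have oscillation at most `2 c̄ / η`, whatever the initial values (`updateV_sub_le`), so that the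
tested quantity bounds both the duality gap (`dualVal_le_add_colDev`) and the distance between the
plans of two potentials (`sq_wnorm_sub_le`). Since the row sums are exact, rounding moves no more
mass than the tested quantity (`roundPlan_spec`). This gives the suboptimality bound
`objective_sub_le`.

The outer loop climbs the optimal dual value `dualVal`, taken at the exact optimum, so that the
inaccuracy of IBP enters through the gradient only and does not accumulate. For a step from `U` to
`U'`, a potential `v'` with arbitrarily small duality gap at `U` is used as a competitor at `U'`. Its
plan is within `ε / (5 c̄)` of the plan of the solver, and smoothness of `wlse` in the costs yields
an increase of at least `τ ε² / 20` as long as the ascent direction is longer than `ε`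
(`dualVal_ascent`). As `dualVal` lies between `-η log n` and `c̄`, the number of steps is at most
`40 c̄ / (τ ε²)`; the bound in the theorem follows since `ε ≤ 2 c̄` and `L₁ ≥ 1` unless the algorithm
breaks at once (`norm_ascentDir_le`, `IsRetractionConst.one_le`).

The existence of the constants of a retraction is Taylor's formula on a compact neighbourhood of the
zero section, together with the boundedness of the Stiefel manifold
(`IsRetraction.exists_isRetractionConst`).
-/

namespace RPRWB

section

/-! ### The log-sum-exp function and the softmax -/

section Softmax

variable {J : Type*} [Fintype J]

/-- `log ∑ j, exp (a j)`. -/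
noncomputable def lse (a : J → ℝ) : ℝ := Real.log (∑ j, Real.exp (a j))

/-- The softmax of `a`, which is the gradient of `lse` at `a`. -/
noncomputable def softmax (a : J → ℝ) (j : J) : ℝ := Real.exp (a j) / ∑ i, Real.exp (a i)

/-- Cauchy–Schwarz in the form that compares the `ℓ¹` distance of `r ^ 2` and `t ^ 2` with the
Hellinger distance. -/
lemma sq_sum_abs_sq_sub_sq_le {κ : Type*} (s : Finset κ) (W r t : κ → ℝ)
    (hW : ∀ i ∈ s, 0 ≤ W i) :
    (∑ i ∈ s, W i * |r i ^ 2 - t i ^ 2|) ^ 2 ≤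
      (∑ i ∈ s, W i * (r i - t i) ^ 2) * ∑ i ∈ s, W i * (r i + t i) ^ 2 := by
  refine Finset.sum_sq_le_sum_mul_sum_of_sq_le_mul s (fun i hi => ?_) (fun i hi => ?_)
    (fun i hi => ?_)
  · have := hW i hi
    positivity
  · have := hW i hi
    positivity
  · rw [mul_pow, sq_abs]
    exact le_of_eq (by ring)

lemma lse_zero : lse (fun _ : J => (0 : ℝ)) = Real.log (Fintype.card J) := by
  simp [lse]

variable [Nonempty J]

lemma sum_exp_pos (a : J → ℝ) : 0 < ∑ j, Real.exp (a j) :=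
  Finset.sum_pos (fun _ _ => Real.exp_pos _) Finset.univ_nonempty

lemma softmax_pos (a : J → ℝ) (j : J) : 0 < softmax a j :=
  div_pos (Real.exp_pos _) (sum_exp_pos a)

lemma sum_softmax (a : J → ℝ) : ∑ j, softmax a j = 1 := by
  simp only [softmax]
  rw [← Finset.sum_div, div_self (sum_exp_pos a).ne']

lemma log_softmax (a : J → ℝ) (j : J) : Real.log (softmax a j) = a j - lse a := by
  rw [softmax, Real.log_div (Real.exp_ne_zero _) (sum_exp_pos a).ne', Real.log_exp, lse]

lemma le_lse (a : J → ℝ) (j : J) : a j ≤ lse a := by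
  rw [lse, Real.le_log_iff_exp_le (sum_exp_pos a)]
  exact Finset.single_le_sum (f := fun j => Real.exp (a j)) (fun i _ => (Real.exp_pos _).le)
    (Finset.mem_univ j)

/-- Strong convexity of `lse` for the `ℓ¹` distance of the gradients. The remainder of the first
order expansion of `lse` is a Kullback–Leibler divergence of softmaxes; it dominates the squared
Hellinger distance, and thus a quarter of the squared `ℓ¹` distance. -/
lemma lse_ge (a b : J → ℝ) :
    lse b + ∑ j, softmax b j * (a j - b j) + (∑ j, |softmax a j - softmax b j|) ^ 2 / 4
      ≤ lse a := by
  set r : J → ℝ := fun j => Real.sqrt (softmax a j) with hr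
  set t : J → ℝ := fun j => Real.sqrt (softmax b j) with ht
  have hrpos : ∀ j, 0 < r j := fun j => Real.sqrt_pos.2 (softmax_pos a j)
  have htpos : ∀ j, 0 < t j := fun j => Real.sqrt_pos.2 (softmax_pos b j)
  have hr2 : ∀ j, r j ^ 2 = softmax a j := fun j => Real.sq_sqrt (softmax_pos a j).le
  have ht2 : ∀ j, t j ^ 2 = softmax b j := fun j => Real.sq_sqrt (softmax_pos b j).le
  have hsr : ∑ j, r j ^ 2 = 1 := by simp only [hr2, sum_softmax]
  have hst : ∑ j, t j ^ 2 = 1 := by simp only [ht2, sum_softmax]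
  have hcs := sq_sum_abs_sq_sub_sq_le Finset.univ (fun _ : J => (1 : ℝ)) r t (by simp)
  simp only [one_mul] at hcs
  have e1 : ∑ j, (r j - t j) ^ 2 = 2 - 2 * ∑ j, r j * t j := by
    have : ∀ j, (r j - t j) ^ 2 = r j ^ 2 + t j ^ 2 - 2 * (r j * t j) := fun j => by ring
    simp only [this, Finset.sum_sub_distrib, Finset.sum_add_distrib, ← Finset.mul_sum, hsr, hst]
    ring
  have e2 : ∑ j, (r j + t j) ^ 2 = 2 + 2 * ∑ j, r j * t j := by
    have : ∀ j, (r j + t j) ^ 2 = r j ^ 2 + t j ^ 2 + 2 * (r j * t j) := fun j => by ring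
    simp only [this, Finset.sum_add_distrib, ← Finset.mul_sum, hsr, hst]
    ring
  rw [e1, e2] at hcs
  simp only [hr2, ht2] at hcs
  -- `log x ≤ x - 1` at `x = √(softmax a / softmax b)`
  have hkl : ∀ j, softmax b j * ((a j - b j) - (lse a - lse b)) ≤ 2 * (r j * t j) - 2 * t j ^ 2 := by
    intro j
    have h1 : (a j - b j) - (lse a - lse b) = 2 * Real.log (r j / t j) := by
      rw [Real.log_div (hrpos j).ne' (htpos j).ne', hr, ht]
      simp only
      rw [Real.log_sqrt (softmax_pos a j).le, Real.log_sqrt (softmax_pos b j).le, log_softmax,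
        log_softmax]
      ring
    have h2 := Real.log_le_sub_one_of_pos (div_pos (hrpos j) (htpos j))
    have h3 : t j ^ 2 * (r j / t j) = r j * t j := by
      field_simp [(htpos j).ne']
    rw [h1, ← ht2]
    nlinarith [mul_le_mul_of_nonneg_left h2 (sq_nonneg (t j))]
  have hs := Finset.sum_le_sum fun j (_ : j ∈ Finset.univ) => hkl j
  simp only [mul_sub, Finset.sum_sub_distrib, ← Finset.sum_mul, ← Finset.mul_sum, sum_softmax,
    hst] at hs
  simp only [mul_sub, Finset.sum_sub_distrib]
  nlinarith [sq_nonneg (∑ j, r j * t j)]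

end Softmax

/-! ### Weighted pairings of plans and costs -/

variable {m n d k : ℕ}

/-- The pairing `∑ l, w l * ⟨π^l, X^l⟩`. -/
noncomputable def wdot (D : Data m n d) (π : Plan m n) (X : Fin m → Fin n → Fin n → ℝ) : ℝ :=
  ∑ l, D.w l * ∑ i, ∑ j, π l i j * X l i j

/-- The weighted `ℓ¹` norm `∑ l, w l * ‖π^l‖₁`. -/
noncomputable def wnorm (D : Data m n d) (π : Plan m n) : ℝ :=
  ∑ l, D.w l * ∑ i, ∑ j, |π l i j|

lemma wdot_sub_left (D : Data m n d) (π σ : Plan m n) (X : Fin m → Fin n → Fin n → ℝ) :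
    wdot D (π - σ) X = wdot D π X - wdot D σ X := by
  simp only [wdot, Pi.sub_apply, Matrix.sub_apply, sub_mul, Finset.sum_sub_distrib, mul_sub]

lemma wdot_sub_right (D : Data m n d) (π : Plan m n) (X Y : Fin m → Fin n → Fin n → ℝ) :
    wdot D π (X - Y) = wdot D π X - wdot D π Y := by
  simp only [wdot, Pi.sub_apply, Finset.sum_sub_distrib, mul_sub]

lemma wdot_add_right (D : Data m n d) (π : Plan m n) (X Y : Fin m → Fin n → Fin n → ℝ) :
    wdot D π (X + Y) = wdot D π X + wdot D π Y := by
  simp only [wdot, Pi.add_apply, Finset.sum_add_distrib, mul_add]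

lemma wdot_smul_right (D : Data m n d) (π : Plan m n) (c : ℝ) (X : Fin m → Fin n → Fin n → ℝ) :
    wdot D π (c • X) = c * wdot D π X := by
  simp only [wdot, Pi.smul_apply, smul_eq_mul, Finset.mul_sum]
  exact Finset.sum_congr rfl fun l _ => Finset.sum_congr rfl fun i _ =>
    Finset.sum_congr rfl fun j _ => by ring

lemma wnorm_sub_le (D : Data m n d) (π σ θ : Plan m n) :
    wnorm D (π - θ) ≤ wnorm D (π - σ) + wnorm D (σ - θ) := by
  simp only [wnorm, ← Finset.sum_add_distrib, ← mul_add]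
  exact Finset.sum_le_sum fun l _ => mul_le_mul_of_nonneg_left (Finset.sum_le_sum fun i _ =>
    Finset.sum_le_sum fun j _ => abs_sub_le _ _ _) (D.w_nonneg l)

lemma wnorm_sub_comm (D : Data m n d) (π σ : Plan m n) :
    wnorm D (π - σ) = wnorm D (σ - π) := by
  simp only [wnorm, Pi.sub_apply, Matrix.sub_apply, abs_sub_comm]

/-- Hölder's inequality. -/
lemma abs_wdot_le (D : Data m n d) (π : Plan m n) (X : Fin m → Fin n → Fin n → ℝ) {B : ℝ}
    (hX : ∀ l i j, |X l i j| ≤ B) : |wdot D π X| ≤ B * wnorm D π := by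
  rw [wdot, wnorm, Finset.mul_sum]
  refine (Finset.abs_sum_le_sum_abs _ _).trans (Finset.sum_le_sum fun l _ => ?_)
  rw [abs_mul, abs_of_nonneg (D.w_nonneg l), mul_left_comm]
  refine mul_le_mul_of_nonneg_left ?_ (D.w_nonneg l)
  rw [Finset.mul_sum]
  refine (Finset.abs_sum_le_sum_abs _ _).trans (Finset.sum_le_sum fun i _ => ?_)
  rw [Finset.mul_sum]
  refine (Finset.abs_sum_le_sum_abs _ _).trans (Finset.sum_le_sum fun j _ => ?_)
  rw [abs_mul, mul_comm]
  exact mul_le_mul_of_nonneg_right (hX l i j) (abs_nonneg _)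

lemma wdot_mono (D : Data m n d) (π : Plan m n) (hπ : ∀ l i j, 0 ≤ π l i j)
    {X Y : Fin m → Fin n → Fin n → ℝ} (h : ∀ l i j, X l i j ≤ Y l i j) :
    wdot D π X ≤ wdot D π Y :=
  Finset.sum_le_sum fun l _ => mul_le_mul_of_nonneg_left (Finset.sum_le_sum fun i _ =>
    Finset.sum_le_sum fun j _ => mul_le_mul_of_nonneg_left (h l i j) (hπ l i j)) (D.w_nonneg l)

lemma wnorm_eq_one (D : Data m n d) (π : Plan m n) (hπ : ∀ l i j, 0 ≤ π l i j)
    (hrow : ∀ l i, ∑ j, π l i j = D.p l i) : wnorm D π = 1 := by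
  simp only [wnorm, abs_of_nonneg (hπ _ _ _), hrow, D.p_sum, mul_one, D.w_sum]

/-- A cost that depends on the column only is paired with the column sums. -/
lemma wdot_col (D : Data m n d) (π : Plan m n) (v : Fin m → Fin n → ℝ) :
    wdot D π (fun l _ j => v l j) = ∑ l, D.w l * ∑ j, colSum π l j * v l j := by
  simp only [wdot, colSum, Finset.sum_mul]
  exact Finset.sum_congr rfl fun l _ => by rw [Finset.sum_comm]

lemma sum_colSum (D : Data m n d) (π : Plan m n) (hrow : ∀ l i, ∑ j, π l i j = D.p l i)
    (l : Fin m) : ∑ j, colSum π l j = 1 := by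
  simp only [colSum]
  rw [Finset.sum_comm]
  simp only [hrow, D.p_sum]

/-! ### The semi-dual function and its gradient -/

/-- `∑ l, w l * ∑ i, p l i * lse (A l i)`. For `A = -C / η + v` this is the negative semi-dual
function of the entropic barycenter problem with costs `C` (divided by `η`). -/
noncomputable def wlse (D : Data m n d) (A : Fin m → Fin n → Fin n → ℝ) : ℝ :=
  ∑ l, D.w l * ∑ i, D.p l i * lse (A l i)

/-- The plan with row sums `p` whose rows are proportional to `exp (A l i)`. -/
noncomputable def softPlan (D : Data m n d) (A : Fin m → Fin n → Fin n → ℝ) : Plan m n :=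
  fun l => Matrix.of fun i j => D.p l i * softmax (A l i) j

lemma softPlan_apply (D : Data m n d) (A : Fin m → Fin n → Fin n → ℝ) (l : Fin m) (i j : Fin n) :
    softPlan D A l i j = D.p l i * softmax (A l i) j := rfl

lemma sum_w_mul_sum_p (D : Data m n d) (c : ℝ) : ∑ l, D.w l * ∑ i, D.p l i * c = c := by
  simp only [← Finset.sum_mul, D.p_sum, D.w_sum, one_mul]

lemma wp_mono (D : Data m n d) {f g : Fin m → Fin n → ℝ} (h : ∀ l i, f l i ≤ g l i) :
    ∑ l, D.w l * ∑ i, D.p l i * f l i ≤ ∑ l, D.w l * ∑ i, D.p l i * g l i :=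
  Finset.sum_le_sum fun l _ => mul_le_mul_of_nonneg_left (Finset.sum_le_sum fun i _ =>
    mul_le_mul_of_nonneg_left (h l i) (D.p_nonneg l i)) (D.w_nonneg l)

lemma wp_add (D : Data m n d) (f g : Fin m → Fin n → ℝ) :
    ∑ l, D.w l * ∑ i, D.p l i * (f l i + g l i) =
      ∑ l, D.w l * ∑ i, D.p l i * f l i + ∑ l, D.w l * ∑ i, D.p l i * g l i := by
  simp only [mul_add, Finset.sum_add_distrib]

lemma wdot_softPlan (D : Data m n d) (A X : Fin m → Fin n → Fin n → ℝ) :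
    wdot D (softPlan D A) X = ∑ l, D.w l * ∑ i, D.p l i * ∑ j, softmax (A l i) j * X l i j := by
  simp only [wdot, softPlan_apply, mul_assoc, ← Finset.mul_sum]

variable [NeZero n]

lemma softPlan_nonneg (D : Data m n d) (A : Fin m → Fin n → Fin n → ℝ) (l : Fin m)
    (i j : Fin n) : 0 ≤ softPlan D A l i j :=
  mul_nonneg (D.p_nonneg l i) (softmax_pos _ _).le

lemma sum_softPlan (D : Data m n d) (A : Fin m → Fin n → Fin n → ℝ) (l : Fin m)
    (i : Fin n) : ∑ j, softPlan D A l i j = D.p l i := by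
  simp only [softPlan_apply, ← Finset.mul_sum, sum_softmax, mul_one]

lemma colSum_softPlan_pos (D : Data m n d) (A : Fin m → Fin n → Fin n → ℝ) (l : Fin m)
    (j : Fin n) : 0 < colSum (softPlan D A) l j := by
  refine Finset.sum_pos' (fun i _ => softPlan_nonneg D A l i j) ?_
  by_contra! h
  have hp : ∀ i, D.p l i ≤ 0 := fun i => by
    by_contra! hi
    exact absurd (h i (Finset.mem_univ i)) (not_le.2 (mul_pos hi (softmax_pos _ _)))
  have := Finset.sum_nonpos fun i (_ : i ∈ Finset.univ) => hp i
  rw [D.p_sum] at this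
  linarith

/-- Strong convexity of `wlse`: the first order expansion with the `ℓ¹` distance of the plans as
remainder. -/
lemma wlse_ge (D : Data m n d) (A B : Fin m → Fin n → Fin n → ℝ) :
    wlse D B + wdot D (softPlan D B) (A - B) + wnorm D (softPlan D A - softPlan D B) ^ 2 / 4
      ≤ wlse D A := by
  set N : Fin m → Fin n → ℝ := fun l i => ∑ j, |softmax (A l i) j - softmax (B l i) j| with hN
  have hnorm : wnorm D (softPlan D A - softPlan D B) = ∑ l, D.w l * ∑ i, D.p l i * N l i := by
    simp only [wnorm, hN, Pi.sub_apply, Matrix.sub_apply, softPlan_apply, ← mul_sub, abs_mul,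
      abs_of_nonneg (D.p_nonneg _ _), Finset.mul_sum]
  set c := ∑ l, D.w l * ∑ i, D.p l i * N l i with hc
  have h1 : wlse D B + wdot D (softPlan D B) (A - B) +
      ∑ l, D.w l * ∑ i, D.p l i * (N l i ^ 2 / 4) ≤ wlse D A := by
    rw [wdot_softPlan, wlse, ← wp_add, ← wp_add]
    exact wp_mono D fun l i => lse_ge _ _
  -- Jensen's inequality for the square: a square lies above its tangent at the mean `c`
  have h2 : c ^ 2 / 4 ≤ ∑ l, D.w l * ∑ i, D.p l i * (N l i ^ 2 / 4) := by
    have : ∑ l, D.w l * ∑ i, D.p l i * ((c / 2) * N l i + (-(c ^ 2 / 4))) ≤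
        ∑ l, D.w l * ∑ i, D.p l i * (N l i ^ 2 / 4) :=
      wp_mono D fun l i => by nlinarith [sq_nonneg (N l i - c)]
    rw [wp_add, sum_w_mul_sum_p] at this
    have e : ∀ b : ℝ, ∑ l, D.w l * ∑ i, D.p l i * (b * N l i) = b * c := fun b => by
      simp only [hc, Finset.mul_sum]
      exact Finset.sum_congr rfl fun l _ => Finset.sum_congr rfl fun i _ => by ring
    rw [e] at this
    nlinarith
  rw [hnorm]
  linarith

/-- Smoothness of `wlse` with respect to the sup norm, from strong convexity by duality. -/
lemma wlse_le_add_sq (D : Data m n d) (A B : Fin m → Fin n → Fin n → ℝ) {M : ℝ}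
    (hM : ∀ l i j, |(A - B) l i j| ≤ M) :
    wlse D A ≤ wlse D B + wdot D (softPlan D B) (A - B) + M ^ 2 := by
  have h1 := wlse_ge D B A
  have h2 := abs_wdot_le D (softPlan D B - softPlan D A) (A - B) hM
  rw [wdot_sub_left] at h2
  have h3 : wdot D (softPlan D A) (B - A) = - wdot D (softPlan D A) (A - B) := by
    rw [wdot_sub_right, wdot_sub_right]
    ring
  have h4 := (abs_le.1 h2).1
  nlinarith [sq_nonneg (wnorm D (softPlan D B - softPlan D A) / 2 - M)]

/-- Monotonicity of the gradient of `wlse`. -/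
lemma sq_wnorm_softPlan_sub_le (D : Data m n d) (A B : Fin m → Fin n → Fin n → ℝ) :
    wnorm D (softPlan D A - softPlan D B) ^ 2 / 2 ≤
      wdot D (softPlan D A) (A - B) - wdot D (softPlan D B) (A - B) := by
  have h1 := wlse_ge D B A
  have h2 := wlse_ge D A B
  have h3 : wdot D (softPlan D A) (B - A) = - wdot D (softPlan D A) (A - B) := by
    rw [wdot_sub_right, wdot_sub_right]
    ring
  rw [wnorm_sub_comm] at h1
  linarith

/-- `wdot D (softPlan D A) A` differs from `wlse D A` by an entropy, which is at most `log n`. -/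
lemma wlse_le_log_add (D : Data m n d) (A : Fin m → Fin n → Fin n → ℝ) :
    wlse D A ≤ Real.log n + wdot D (softPlan D A) A := by
  have h : wlse D A ≤ ∑ l, D.w l * ∑ i, D.p l i *
      (Real.log n + ∑ j, softmax (A l i) j * A l i j) := by
    refine wp_mono D fun l i => ?_
    have := lse_ge (fun _ => (0 : ℝ)) (A l i)
    rw [lse_zero, Fintype.card_fin] at this
    simp only [zero_sub, mul_neg, Finset.sum_neg_distrib] at this
    have h0 := sq_nonneg (∑ j, |softmax (fun _ : Fin n => (0 : ℝ)) j - softmax (A l i) j|)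
    linarith
  rwa [wp_add, sum_w_mul_sum_p, ← wdot_softPlan] at h

/-- Weak duality. -/
lemma wdot_le_wlse (D : Data m n d) (π : Plan m n) (hπ : ∀ l i j, 0 ≤ π l i j)
    (hrow : ∀ l i, ∑ j, π l i j = D.p l i) (A : Fin m → Fin n → Fin n → ℝ) :
    wdot D π A ≤ wlse D A := by
  refine (wdot_mono D π hπ (Y := fun l i _ => lse (A l i)) fun l i j => le_lse _ _).trans
    (le_of_eq ?_)
  simp only [wdot, wlse, ← Finset.sum_mul, hrow]

end

section

/-! ### Projected costs and the correlation matrix -/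

variable {m n d k : ℕ}

/-- The vector `Uᵀ z`. -/
noncomputable def projVec (U : Matrix (Fin d) (Fin k) ℝ) (z : EuclideanSpace ℝ (Fin d)) :
    EuclideanSpace ℝ (Fin k) := WithLp.toLp 2 (Uᵀ *ᵥ z.ofLp)

/-- The bilinear form `⟨Uᵀ z, Hᵀ z⟩` with `z = x l i - y j`; its diagonal is `projCost`. -/
noncomputable def projInner (D : Data m n d) (U H : Matrix (Fin d) (Fin k) ℝ) (l : Fin m)
    (i j : Fin n) : ℝ := inner ℝ (projVec U (D.x l i - D.y j)) (projVec H (D.x l i - D.y j))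

lemma frobenius_inner_def (A B : Matrix (Fin d) (Fin k) ℝ) : inner ℝ A B = (Aᵀ * B).trace := rfl

lemma projVec_add (U H : Matrix (Fin d) (Fin k) ℝ) (z : EuclideanSpace ℝ (Fin d)) :
    projVec (U + H) z = projVec U z + projVec H z := by
  simp [projVec, Matrix.add_mulVec]

lemma projVec_sub (U H : Matrix (Fin d) (Fin k) ℝ) (z : EuclideanSpace ℝ (Fin d)) :
    projVec (U - H) z = projVec U z - projVec H z := by
  simp [projVec, Matrix.sub_mulVec]

lemma norm_projVec_le (H : Matrix (Fin d) (Fin k) ℝ) (z : EuclideanSpace ℝ (Fin d)) :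
    ‖projVec H z‖ ≤ ‖H‖ * ‖z‖ := by
  have hH : ‖H‖ ^ 2 = ∑ j, ∑ i, H i j ^ 2 := by
    rw [← real_inner_self_eq_norm_sq, frobenius_inner_def]
    simp only [Matrix.trace, Matrix.diag_apply, Matrix.mul_apply, Matrix.transpose_apply, sq]
  refine le_of_sq_le_sq ?_ (by positivity)
  rw [mul_pow, hH, EuclideanSpace.norm_sq_eq, EuclideanSpace.norm_sq_eq, Finset.sum_mul]
  refine Finset.sum_le_sum fun j _ => ?_
  simp only [Real.norm_eq_abs, sq_abs, projVec, Matrix.mulVec, dotProduct, Matrix.transpose_apply]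
  exact Finset.sum_mul_sq_le_sq_mul_sq _ _ _

lemma norm_projVec_le_of_mem_stiefel {U : Matrix (Fin d) (Fin k) ℝ} (hU : U ∈ stiefel d k)
    (z : EuclideanSpace ℝ (Fin d)) : ‖projVec U z‖ ≤ ‖z‖ := by
  have hU' : Uᵀ * U = 1 := hU
  -- `U Uᵀ` is an orthogonal projection
  set y : EuclideanSpace ℝ (Fin d) := WithLp.toLp 2 (U *ᵥ (Uᵀ *ᵥ z.ofLp)) with hy
  have h1 : inner ℝ z y = ‖projVec U z‖ ^ 2 := by
    rw [← real_inner_self_eq_norm_sq, projVec]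
    simp only [EuclideanSpace.inner_eq_star_dotProduct, hy, star_trivial]
    rw [dotProduct_comm, Matrix.dotProduct_mulVec, ← Matrix.mulVec_transpose]
  have h2 : ‖y‖ ^ 2 = ‖projVec U z‖ ^ 2 := by
    rw [← real_inner_self_eq_norm_sq, ← real_inner_self_eq_norm_sq, projVec]
    simp only [EuclideanSpace.inner_eq_star_dotProduct, hy, star_trivial]
    rw [Matrix.dotProduct_mulVec, ← Matrix.mulVec_transpose, Matrix.mulVec_mulVec, hU',
      Matrix.one_mulVec]
  have h3 : 0 ≤ ‖z - y‖ ^ 2 := sq_nonneg _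
  rw [norm_sub_sq_real, h1, h2] at h3
  exact le_of_sq_le_sq (by linarith) (norm_nonneg _)

lemma projCost_eq (D : Data m n d) (U : Matrix (Fin d) (Fin k) ℝ) (l : Fin m) (i j : Fin n) :
    projCost D U l i j = ‖projVec U (D.x l i - D.y j)‖ ^ 2 := rfl

lemma projInner_self (D : Data m n d) (U : Matrix (Fin d) (Fin k) ℝ) (l : Fin m) (i j : Fin n) :
    projInner D U U l i j = projCost D U l i j := by
  rw [projInner, real_inner_self_eq_norm_sq, projCost_eq]

lemma projCost_nonneg (D : Data m n d) (U : Matrix (Fin d) (Fin k) ℝ) (l : Fin m) (i j : Fin n) :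
    0 ≤ projCost D U l i j := by
  rw [projCost_eq]
  positivity

lemma sq_norm_sub_le_cbar (D : Data m n d) (l : Fin m) (i j : Fin n) :
    ‖D.x l i - D.y j‖ ^ 2 ≤ cbar D :=
  le_ciSup (f := fun t : Fin m × Fin n × Fin n => ‖D.x t.1 t.2.1 - D.y t.2.2‖ ^ 2)
    (Set.finite_range _).bddAbove (l, i, j)

lemma cbar_nonneg (D : Data m n d) : 0 ≤ cbar D := Real.iSup_nonneg fun _ => sq_nonneg _

lemma abs_projInner_le (D : Data m n d) (U H : Matrix (Fin d) (Fin k) ℝ) (l : Fin m)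
    (i j : Fin n) : |projInner D U H l i j| ≤ ‖U‖ * ‖H‖ * cbar D := by
  have hz := sq_norm_sub_le_cbar D l i j
  calc |projInner D U H l i j|
      ≤ ‖projVec U (D.x l i - D.y j)‖ * ‖projVec H (D.x l i - D.y j)‖ := abs_real_inner_le_norm _ _
    _ ≤ (‖U‖ * ‖D.x l i - D.y j‖) * (‖H‖ * ‖D.x l i - D.y j‖) := by
        gcongr <;> exact norm_projVec_le _ _
    _ = ‖U‖ * ‖H‖ * ‖D.x l i - D.y j‖ ^ 2 := by ring
    _ ≤ ‖U‖ * ‖H‖ * cbar D := by gcongr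

lemma abs_projInner_le_of_mem_stiefel (D : Data m n d) {U : Matrix (Fin d) (Fin k) ℝ}
    (hU : U ∈ stiefel d k) (H : Matrix (Fin d) (Fin k) ℝ) (l : Fin m)
    (i j : Fin n) : |projInner D U H l i j| ≤ cbar D * ‖H‖ := by
  have hz := sq_norm_sub_le_cbar D l i j
  calc |projInner D U H l i j|
      ≤ ‖projVec U (D.x l i - D.y j)‖ * ‖projVec H (D.x l i - D.y j)‖ := abs_real_inner_le_norm _ _
    _ ≤ ‖D.x l i - D.y j‖ * (‖H‖ * ‖D.x l i - D.y j‖) := by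
        gcongr
        · exact norm_projVec_le_of_mem_stiefel hU _
        · exact norm_projVec_le _ _
    _ = ‖D.x l i - D.y j‖ ^ 2 * ‖H‖ := by ring
    _ ≤ cbar D * ‖H‖ := by gcongr

lemma projCost_le_cbar (D : Data m n d) {U : Matrix (Fin d) (Fin k) ℝ}
    (hU : U ∈ stiefel d k) (l : Fin m) (i j : Fin n) : projCost D U l i j ≤ cbar D := by
  rw [projCost_eq]
  exact (pow_le_pow_left₀ (norm_nonneg _) (norm_projVec_le_of_mem_stiefel hU _) 2).trans
    (sq_norm_sub_le_cbar D l i j)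

lemma projCost_add (D : Data m n d) (U H : Matrix (Fin d) (Fin k) ℝ) :
    projCost D (U + H) = projCost D U + (2 : ℝ) • projInner D U H + projCost D H := by
  ext l i j
  simp only [Pi.add_apply, Pi.smul_apply, smul_eq_mul, projCost_eq, projVec_add, projInner]
  rw [norm_add_sq_real]

/-- On the Stiefel manifold, the projected costs are `2 c̄`-Lipschitz in the sup norm. -/
lemma abs_projCost_sub_le (D : Data m n d) {U U' : Matrix (Fin d) (Fin k) ℝ}
    (hU : U ∈ stiefel d k) (hU' : U' ∈ stiefel d k) (l : Fin m) (i j : Fin n) :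
    |projCost D U' l i j - projCost D U l i j| ≤ 2 * cbar D * ‖U' - U‖ := by
  have h : projCost D U' l i j - projCost D U l i j =
      projInner D U' (U' - U) l i j + projInner D U (U' - U) l i j := by
    simp only [← projInner_self, projInner, projVec_sub, inner_sub_right]
    rw [real_inner_comm (projVec U' _) (projVec U _)]
    ring
  rw [h]
  refine (abs_add_le _ _).trans ?_
  linarith [abs_projInner_le_of_mem_stiefel D hU (U' - U) l i j,
    abs_projInner_le_of_mem_stiefel D hU' (U' - U) l i j]

lemma objective_eq_wdot (D : Data m n d) (π : Plan m n) (U : Matrix (Fin d) (Fin k) ℝ) :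
    objective D π U = wdot D π (projCost D U) := rfl

lemma inner_corr_mul (D : Data m n d) (π : Plan m n) (U H : Matrix (Fin d) (Fin k) ℝ) :
    inner ℝ (corr D π * U) H = wdot D π (projInner D U H) := by
  have key : ∀ a : Fin d → ℝ, ((Matrix.vecMulVec a a * U)ᵀ * H).trace =
      (Uᵀ *ᵥ a) ⬝ᵥ (Hᵀ *ᵥ a) := fun a => by
    rw [Matrix.vecMulVec_mul, Matrix.transpose_vecMulVec, Matrix.vecMulVec_mul,
      Matrix.trace_vecMulVec, Matrix.mulVec_transpose, Matrix.mulVec_transpose]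
  rw [frobenius_inner_def, corr]
  simp only [wdot, projInner, EuclideanSpace.inner_eq_star_dotProduct, projVec, star_trivial,
    Matrix.sum_mul, Matrix.smul_mul, Matrix.transpose_sum, Matrix.transpose_smul,
    Matrix.trace_sum, Matrix.trace_smul, key, smul_eq_mul]
  simp only [dotProduct_comm]

/-- The ascent direction represents the derivative of the objective on the tangent space. -/
lemma inner_ascentDir (D : Data m n d) (π : Plan m n) (U ξ : Matrix (Fin d) (Fin k) ℝ)
    (hξ : ξ ∈ tangentSpace U) :
    inner ℝ (ascentDir D π U) ξ = 2 * wdot D π (projInner D U ξ) := by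
  have h := (tangentSpace U).starProjection_inner_eq_zero ((2 : ℝ) • (corr D π * U)) ξ hξ
  rw [inner_sub_left, inner_smul_left, inner_corr_mul] at h
  simp only [conj_trivial] at h
  rw [ascentDir, tangentProj]
  linarith

lemma ascentDir_mem (D : Data m n d) (π : Plan m n) (U : Matrix (Fin d) (Fin k) ℝ) :
    ascentDir D π U ∈ tangentSpace U := Submodule.starProjection_apply_mem _ _

lemma norm_ascentDir_le (D : Data m n d) (π : Plan m n) {U : Matrix (Fin d) (Fin k) ℝ}
    (hU : U ∈ stiefel d k) (hπ : wnorm D π = 1) : ‖ascentDir D π U‖ ≤ 2 * cbar D := by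
  set ξ := ascentDir D π U with hξ
  have h := inner_ascentDir D π U ξ (ascentDir_mem D π U)
  have h2 := abs_wdot_le D π _ (fun l i j => abs_projInner_le_of_mem_stiefel D hU ξ l i j)
  rw [← hξ, real_inner_self_eq_norm_sq] at h
  rw [hπ, mul_one] at h2
  have h3 := (abs_le.1 h2).2
  rcases (norm_nonneg ξ).eq_or_lt with h0 | h0
  · rw [← h0]
    linarith [cbar_nonneg D]
  · nlinarith

lemma hasGradientAt_objective (D : Data m n d) (π : Plan m n) (U : Matrix (Fin d) (Fin k) ℝ) :
    HasGradientAt (fun W => objective D π W) ((2 : ℝ) • (corr D π * U)) U := by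
  rw [hasGradientAt_iff_isLittleO_nhds_zero]
  have h : ∀ H : Matrix (Fin d) (Fin k) ℝ, objective D π (U + H) - objective D π U -
      inner ℝ ((2 : ℝ) • (corr D π * U)) H = objective D π H := fun H => by
    simp only [objective_eq_wdot, projCost_add, wdot_add_right, wdot_smul_right,
      inner_smul_left, inner_corr_mul, conj_trivial]
    ring
  simp only [h]
  refine Asymptotics.IsBigO.trans_isLittleO (g := fun H => ‖H‖ ^ 2) ?_ ?_
  · refine Asymptotics.IsBigO.of_bound (cbar D * wnorm D π) (Filter.Eventually.of_forall fun H => ?_)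
    rw [Real.norm_eq_abs, objective_eq_wdot]
    refine (abs_wdot_le D π _ (B := ‖H‖ * ‖H‖ * cbar D) fun l i j => ?_).trans (le_of_eq ?_)
    · rw [← projInner_self]
      exact abs_projInner_le D H H l i j
    · rw [Real.norm_eq_abs, abs_of_nonneg (sq_nonneg _)]
      ring
  · exact Asymptotics.isLittleO_norm_pow_id one_lt_two

lemma riemannianGrad_objective (D : Data m n d) (π : Plan m n) (U : Matrix (Fin d) (Fin k) ℝ) :
    riemannianGrad (fun W => objective D π W) U = ascentDir D π U := by
  rw [riemannianGrad, (hasGradientAt_objective D π U).gradient, ascentDir]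

/-! ### Feasible plans -/

lemma wnorm_eq_one_of_feasible (D : Data m n d) {π : Plan m n} (hπ : π ∈ feasible D) :
    wnorm D π = 1 := wnorm_eq_one D π hπ.1 hπ.2.1

/-- The costs of potentials with `∑ l, w l * v l = 0` vanish on feasible plans. -/
lemma wdot_potential_of_feasible (D : Data m n d) {π : Plan m n} (hπ : π ∈ feasible D)
    {v : Fin m → Fin n → ℝ} (hv : ∀ j, ∑ l, D.w l * v l j = 0) :
    wdot D π (fun l _ j => v l j) = 0 := by
  rw [wdot_col]
  have hm : Nonempty (Fin m) := by
    by_contra h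
    rw [not_nonempty_iff] at h
    simpa using D.w_sum
  obtain ⟨l₀⟩ := hm
  have : ∀ l, ∑ j, colSum π l j * v l j = ∑ j, colSum π l₀ j * v l j := fun l =>
    Finset.sum_congr rfl fun j _ => by rw [colSum, hπ.2.2 l l₀ j, colSum]
  simp only [this, Finset.mul_sum]
  rw [Finset.sum_comm]
  refine Finset.sum_eq_zero fun j _ => ?_
  rw [← mul_zero (colSum π l₀ j), ← hv j, Finset.mul_sum]
  exact Finset.sum_congr rfl fun l _ => by ring

lemma exists_mem_feasible [NeZero n] (D : Data m n d) : ∃ π, π ∈ feasible D := by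
  refine ⟨fun l => Matrix.of fun i _ => D.p l i / n, ?_, ?_, ?_⟩
  · exact fun l i j => div_nonneg (D.p_nonneg l i) (Nat.cast_nonneg n)
  · intro l i
    have : (n : ℝ) ≠ 0 := Nat.cast_ne_zero.2 (NeZero.ne n)
    simp only [Matrix.of_apply, Finset.sum_const, Finset.card_univ, Fintype.card_fin, nsmul_eq_mul]
    field_simp
  · intro l l' j
    simp only [Matrix.of_apply, ← Finset.sum_div, D.p_sum]

lemma isCompact_feasible (D : Data m n d) : IsCompact (feasible D) := by
  have hev : ∀ (l : Fin m) (i j : Fin n), Continuous fun π : Plan m n => π l i j := fun l i j =>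
    (continuous_apply_apply i j).comp (continuous_apply l)
  have hcl : IsClosed (feasible D) := by
    refine IsClosed.and ?_ (IsClosed.and ?_ ?_)
    · simp only [Set.ofPred_forall]
      exact isClosed_iInter fun l => isClosed_iInter fun i => isClosed_iInter fun j =>
        isClosed_le continuous_const (hev l i j)
    · simp only [Set.ofPred_forall]
      exact isClosed_iInter fun l => isClosed_iInter fun i =>
        isClosed_eq (continuous_finsetSum _ fun j _ => hev l i j) continuous_const
    · simp only [Set.ofPred_forall]
      exact isClosed_iInter fun l => isClosed_iInter fun l' => isClosed_iInter fun j =>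
        isClosed_eq (continuous_finsetSum _ fun i _ => hev l i j)
          (continuous_finsetSum _ fun i _ => hev l' i j)
  have hK : IsCompact (Set.univ.pi fun l : Fin m => Set.univ.pi fun i : Fin n =>
      Set.univ.pi fun _ : Fin n => Set.Icc (0 : ℝ) (D.p l i)) :=
    isCompact_univ_pi fun l => isCompact_univ_pi fun i => isCompact_univ_pi fun _ => isCompact_Icc
  refine hK.of_isClosed_subset hcl fun π hπ => ?_
  simp only [Set.mem_pi, Set.mem_univ, forall_true_left]
  refine fun l i j => ⟨hπ.1 l i j, ?_⟩
  rw [← hπ.2.1 l i]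
  exact Finset.single_le_sum (f := fun j => π l i j) (fun j _ => hπ.1 l i j) (Finset.mem_univ j)

lemma exists_isMinOn_objective [NeZero n] (D : Data m n d) (U : Matrix (Fin d) (Fin k) ℝ) :
    ∃ πs ∈ feasible D, IsMinOn (fun π' => objective D π' U) (feasible D) πs := by
  refine (isCompact_feasible D).exists_isMinOn (exists_mem_feasible D) (Continuous.continuousOn ?_)
  unfold objective
  refine continuous_finsetSum _ fun l _ => continuous_const.mul (continuous_finsetSum _ fun i _ =>
    continuous_finsetSum _ fun j _ => Continuous.mul ?_ continuous_const)
  exact (continuous_apply_apply i j).comp (continuous_apply l)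

end

section

/-! ### Rounding a plan whose row sums are already correct -/

section Rounding

variable {n : ℕ} (P : Matrix (Fin n) (Fin n) ℝ) (p q : Fin n → ℝ)

/-- If the row sums of `P` are `p`, then rounding does not rescale the rows. -/
lemma roundPlan_apply (hP : ∀ i j, 0 ≤ P i j) (hrow : ∀ i, ∑ j, P i j = p i) (i j : Fin n) :
    roundPlan P p q i j = P i j * min (q j / ∑ i, P i j) 1 +
      (p i - ∑ j, P i j * min (q j / ∑ i, P i j) 1) *
      (q j - ∑ i, P i j * min (q j / ∑ i, P i j) 1) /
      ∑ i', |p i' - ∑ j, P i' j * min (q j / ∑ i, P i j) 1| := by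
  have hX : (Matrix.diagonal fun i => min (p i / ∑ j, P i j) 1) * P = P := by
    ext i j
    rw [Matrix.diagonal_mul, hrow]
    by_cases h : p i = 0
    · have h0 : P i j = 0 := by
        rw [← hrow i] at h
        exact (Finset.sum_eq_zero_iff_of_nonneg fun j _ => hP i j).1 h j (Finset.mem_univ j)
      rw [h0, mul_zero]
    · rw [div_self h, min_self, one_mul]
  simp only [roundPlan, hX, Matrix.mul_diagonal, Matrix.of_apply]

/-- Rounding yields a plan with the prescribed marginals; if the row sums are already correct, it
moves no more mass than the distance of the column sums. -/
lemma roundPlan_spec (hP : ∀ i j, 0 ≤ P i j) (hrow : ∀ i, ∑ j, P i j = p i) (hq : ∀ j, 0 ≤ q j)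
    (hcol : ∀ j, 0 < ∑ i, P i j) (hpq : ∑ i, p i = ∑ j, q j) :
    (∀ i j, 0 ≤ roundPlan P p q i j) ∧ (∀ i, ∑ j, roundPlan P p q i j = p i) ∧
    (∀ j, ∑ i, roundPlan P p q i j = q j) ∧
    ∑ i, ∑ j, |roundPlan P p q i j - P i j| ≤ ∑ j, |(∑ i, P i j) - q j| := by
  have happ := roundPlan_apply P p q hP hrow
  set y : Fin n → ℝ := fun j => min (q j / ∑ i, P i j) 1 with hy
  have hy0 : ∀ j, 0 ≤ y j := fun j => le_min (div_nonneg (hq j) (hcol j).le) zero_le_one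
  have hy1 : ∀ j, y j ≤ 1 := fun j => min_le_right _ _
  have hyc : ∀ j, (∑ i, P i j) * y j = min (q j) (∑ i, P i j) := fun j => by
    rw [hy, mul_min_of_nonneg _ _ (hcol j).le, mul_one, mul_div_cancel₀ _ (hcol j).ne']
  set e : Fin n → ℝ := fun i => p i - ∑ j, P i j * y j with he
  set f : Fin n → ℝ := fun j => q j - ∑ i, P i j * y j with hf
  have hf' : ∀ j, f j = q j - min (q j) (∑ i, P i j) := fun j => by
    rw [hf, ← hyc j, Finset.sum_mul]
  have he0 : ∀ i, 0 ≤ e i := fun i => by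
    rw [he, sub_nonneg, ← hrow i]
    exact Finset.sum_le_sum fun j _ => mul_le_of_le_one_right (hP i j) (hy1 j)
  have hf0 : ∀ j, 0 ≤ f j := fun j => by
    rw [hf' j]
    linarith [min_le_left (q j) (∑ i, P i j)]
  have hef : ∑ j, f j = ∑ i, e i := by
    simp only [he, hf, Finset.sum_sub_distrib, hpq]
    rw [Finset.sum_comm]
  have habs : ∑ i', |e i'| = ∑ i', e i' := by simp only [abs_of_nonneg (he0 _)]
  have happ' : ∀ i j, roundPlan P p q i j = P i j * y j + e i * f j / ∑ i', e i' := fun i j => by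
    rw [happ i j, ← habs]
  have hS : 0 ≤ ∑ i, e i := Finset.sum_nonneg fun i _ => he0 i
  have hcorr : ∀ i j, 0 ≤ e i * f j / ∑ i', e i' := fun i j =>
    div_nonneg (mul_nonneg (he0 i) (hf0 j)) hS
  have hrowc : ∀ i, ∑ j, e i * f j / ∑ i', e i' = e i := fun i => by
    rw [← Finset.sum_div, ← Finset.mul_sum, hef]
    by_cases h : ∑ i', e i' = 0
    · rw [(Finset.sum_eq_zero_iff_of_nonneg fun i _ => he0 i).1 h i (Finset.mem_univ i)]
      simp
    · rw [mul_div_assoc, div_self h, mul_one]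
  have hcolc : ∀ j, ∑ i, e i * f j / ∑ i', e i' = f j := fun j => by
    rw [← Finset.sum_div, ← Finset.sum_mul]
    by_cases h : ∑ i', e i' = 0
    · rw [h, ← (Finset.sum_eq_zero_iff_of_nonneg fun j _ => hf0 j).1 (hef.trans h) j
        (Finset.mem_univ j)]
      simp
    · rw [mul_div_assoc, mul_div_cancel₀ _ h]
  refine ⟨fun i j => ?_, fun i => ?_, fun j => ?_, ?_⟩
  · rw [happ']
    exact add_nonneg (mul_nonneg (hP i j) (hy0 j)) (hcorr i j)
  · simp only [happ', Finset.sum_add_distrib, hrowc]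
    simp only [he]
    ring
  · simp only [happ', Finset.sum_add_distrib, hcolc]
    simp only [hf]
    ring
  · have hb : ∀ i j, |roundPlan P p q i j - P i j| ≤
        (P i j - P i j * y j) + e i * f j / ∑ i', e i' := fun i j => by
      rw [happ', abs_le]
      have h1 := hcorr i j
      have h2 := mul_le_of_le_one_right (hP i j) (hy1 j)
      constructor <;> linarith
    refine (Finset.sum_le_sum fun i _ => Finset.sum_le_sum fun j _ => hb i j).trans ?_
    have h1 : ∀ j, |(∑ i, P i j) - q j| =
        ((∑ i, P i j) - min (q j) (∑ i, P i j)) + (q j - min (q j) (∑ i, P i j)) := fun j => by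
      rcases le_total (q j) (∑ i, P i j) with h | h
      · rw [min_eq_left h, abs_of_nonneg (by linarith)]
        ring
      · rw [min_eq_right h, abs_of_nonpos (by linarith)]
        ring
    rw [Finset.sum_comm]
    refine le_of_eq (Finset.sum_congr rfl fun j _ => ?_)
    rw [Finset.sum_add_distrib, hcolc, h1, Finset.sum_sub_distrib, hf' j, ← hyc j, Finset.sum_mul]

end Rounding

/-! ### The iterates of the IBP solver -/

variable {m n d k : ℕ}

/-- The exponent `-C^l_{ij} / η + v^l_j`, where `C` is the projected cost. -/
noncomputable def expo (D : Data m n d) (U : Matrix (Fin d) (Fin k) ℝ) (η : ℝ)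
    (v : Fin m → Fin n → ℝ) : Fin m → Fin n → Fin n → ℝ :=
  fun l i j => -projCost D U l i j / η + v l j

lemma expo_eq (D : Data m n d) (U : Matrix (Fin d) (Fin k) ℝ) (η : ℝ)
    (v : Fin m → Fin n → ℝ) :
    expo D U η v = (-η⁻¹) • projCost D U + fun l _ j => v l j := by
  ext l i j
  simp only [expo, Pi.add_apply, Pi.smul_apply, smul_eq_mul]
  ring

/-- The total deviation of the column sums of the `π l` from their mean, which is the quantity that
`ibpTest` bounds. -/
noncomputable def colDev (D : Data m n d) (π : Plan m n) : ℝ :=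
  ∑ l, D.w l * ∑ j, |colSum π l j - ∑ l', D.w l' * colSum π l' j|

lemma exists_p_ne_zero (D : Data m n d) (l : Fin m) : ∃ i, D.p l i ≠ 0 := by
  by_contra! h
  simpa [h] using D.p_sum l

lemma gibbs_eq_mul (D : Data m n d) (U : Matrix (Fin d) (Fin k) ℝ) (η : ℝ)
    (u v : Fin m → Fin n → ℝ) (l : Fin m) (i j : Fin n) :
    gibbs D U η u v l i j =
      (if D.p l i = 0 then 0 else Real.exp (-projCost D U l i j / η + u l i)) *
        Real.exp (v l j) := by
  simp only [gibbs, Matrix.of_apply]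
  split_ifs
  · rw [zero_mul]
  · rw [Real.exp_add]

/-- The column sums of the Gibbs plan are `exp v` times this kernel sum. -/
noncomputable def kernelSum (D : Data m n d) (U : Matrix (Fin d) (Fin k) ℝ) (η : ℝ)
    (u : Fin m → Fin n → ℝ) (l : Fin m) (j : Fin n) : ℝ :=
  ∑ i, if D.p l i = 0 then 0 else Real.exp (-projCost D U l i j / η + u l i)

lemma kernelSum_pos (D : Data m n d) (U : Matrix (Fin d) (Fin k) ℝ) (η : ℝ)
    (u : Fin m → Fin n → ℝ) (l : Fin m) (j : Fin n) : 0 < kernelSum D U η u l j := by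
  obtain ⟨i, hi⟩ := exists_p_ne_zero D l
  refine Finset.sum_pos' (fun i _ => ?_) ⟨i, Finset.mem_univ i, ?_⟩
  · split_ifs
    · exact le_rfl
    · exact (Real.exp_pos _).le
  · rw [if_neg hi]
    exact Real.exp_pos _

lemma colSum_gibbs (D : Data m n d) (U : Matrix (Fin d) (Fin k) ℝ) (η : ℝ)
    (u v : Fin m → Fin n → ℝ) (l : Fin m) (j : Fin n) :
    colSum (gibbs D U η u v) l j = kernelSum D U η u l j * Real.exp (v l j) := by
  simp only [colSum, kernelSum, gibbs_eq_mul, Finset.sum_mul]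

lemma colSum_gibbs_pos (D : Data m n d) (U : Matrix (Fin d) (Fin k) ℝ) (η : ℝ)
    (u v : Fin m → Fin n → ℝ) (l : Fin m) (j : Fin n) : 0 < colSum (gibbs D U η u v) l j := by
  rw [colSum_gibbs]
  exact mul_pos (kernelSum_pos D U η u l j) (Real.exp_pos _)

lemma updateV_eq (D : Data m n d) (U : Matrix (Fin d) (Fin k) ℝ) (η : ℝ)
    (u v : Fin m → Fin n → ℝ) (l : Fin m) (j : Fin n) :
    updateV D U η u v l j = v l j + (∑ l', D.w l' * Real.log (colSum (gibbs D U η u v) l' j) -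
      Real.log (colSum (gibbs D U η u v) l j)) := by
  rw [updateV, Real.log_div (Real.exp_ne_zero _) (colSum_gibbs_pos D U η u v l j).ne',
    Real.log_exp]

lemma sum_w_mul_updateV (D : Data m n d) (U : Matrix (Fin d) (Fin k) ℝ) (η : ℝ)
    (u v : Fin m → Fin n → ℝ) (j : Fin n) :
    ∑ l, D.w l * updateV D U η u v l j = ∑ l, D.w l * v l j := by
  simp only [updateV_eq, mul_add, mul_sub, Finset.sum_add_distrib, Finset.sum_sub_distrib,
    ← Finset.sum_mul, D.w_sum]
  ring

lemma sum_w_mul_ibpIter (D : Data m n d) (U : Matrix (Fin d) (Fin k) ℝ) (η : ℝ)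
    (init : (Fin m → Fin n → ℝ) × (Fin m → Fin n → ℝ))
    (hinit : ∀ j, ∑ l, D.w l * init.2 l j = 0) (s : ℕ) (j : Fin n) :
    ∑ l, D.w l * (ibpIter D U η init s).2 l j = 0 := by
  induction s with
  | zero => exact hinit j
  | succ s ih =>
    simp only [ibpIter, sum_w_mul_updateV]
    exact ih

/-- The potential `v` after an update only depends on kernel sums, not on its previous value. -/
lemma updateV_eq_kernelSum (D : Data m n d) (U : Matrix (Fin d) (Fin k) ℝ) (η : ℝ)
    (u v : Fin m → Fin n → ℝ) (hv : ∀ j, ∑ l, D.w l * v l j = 0) (l : Fin m) (j : Fin n) :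
    updateV D U η u v l j = ∑ l', D.w l' * Real.log (kernelSum D U η u l' j) -
      Real.log (kernelSum D U η u l j) := by
  have hlog : ∀ l, Real.log (colSum (gibbs D U η u v) l j) =
      Real.log (kernelSum D U η u l j) + v l j := fun l => by
    rw [colSum_gibbs, Real.log_mul (kernelSum_pos D U η u l j).ne' (Real.exp_ne_zero _),
      Real.log_exp]
  simp only [updateV_eq, hlog, mul_add, Finset.sum_add_distrib, hv j]
  ring

lemma log_kernelSum_le (D : Data m n d) {U : Matrix (Fin d) (Fin k) ℝ} (hU : U ∈ stiefel d k)
    {η : ℝ} (hη : 0 < η) (u : Fin m → Fin n → ℝ) (l : Fin m) (j j' : Fin n) :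
    Real.log (kernelSum D U η u l j) ≤ cbar D / η + Real.log (kernelSum D U η u l j') := by
  rw [Real.log_le_iff_le_exp (kernelSum_pos D U η u l j), Real.exp_add,
    Real.exp_log (kernelSum_pos D U η u l j'), kernelSum, kernelSum, Finset.mul_sum]
  refine Finset.sum_le_sum fun i _ => ?_
  split_ifs
  · rw [mul_zero]
  · rw [← Real.exp_add, Real.exp_le_exp]
    have h1 : 0 ≤ projCost D U l i j / η := div_nonneg (projCost_nonneg D U l i j) hη.le
    have h2 : projCost D U l i j' / η ≤ cbar D / η := by
      have := projCost_le_cbar D hU l i j'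
      gcongr
    rw [neg_div, neg_div]
    linarith

/-- The oscillation of the potentials `v` after at least one update, for arbitrary initial
values. -/
lemma updateV_sub_le (D : Data m n d) {U : Matrix (Fin d) (Fin k) ℝ} (hU : U ∈ stiefel d k)
    {η : ℝ} (hη : 0 < η) (u v : Fin m → Fin n → ℝ) (hv : ∀ j, ∑ l, D.w l * v l j = 0)
    (l : Fin m) (j j' : Fin n) :
    updateV D U η u v l j - updateV D U η u v l j' ≤ 2 * cbar D / η := by
  rw [updateV_eq_kernelSum D U η u v hv, updateV_eq_kernelSum D U η u v hv]
  have h1 := log_kernelSum_le D hU hη u l j' j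
  have h2 : ∑ l', D.w l' * Real.log (kernelSum D U η u l' j) ≤
      ∑ l', D.w l' * (cbar D / η + Real.log (kernelSum D U η u l' j')) :=
    Finset.sum_le_sum fun l' _ =>
      mul_le_mul_of_nonneg_left (log_kernelSum_le D hU hη u l' j j') (D.w_nonneg l')
  simp only [mul_add, Finset.sum_add_distrib, ← Finset.sum_mul, D.w_sum, one_mul] at h2
  have h3 : 2 * cbar D / η = cbar D / η + cbar D / η := by ring
  linarith

lemma ibpIter_sub_le (D : Data m n d) {U : Matrix (Fin d) (Fin k) ℝ} (hU : U ∈ stiefel d k)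
    {η : ℝ} (hη : 0 < η) (init : (Fin m → Fin n → ℝ) × (Fin m → Fin n → ℝ))
    (hinit : ∀ j, ∑ l, D.w l * init.2 l j = 0) (s : ℕ) (l : Fin m) (j j' : Fin n) :
    (ibpIter D U η init (s + 1)).2 l j - (ibpIter D U η init (s + 1)).2 l j' ≤
      2 * cbar D / η :=
  updateV_sub_le D hU hη _ _ (sum_w_mul_ibpIter D U η init hinit s) l j j'

/-! ### Arithmetic and geometric means of the column sums -/

/-- The weighted arithmetic and geometric means of the column sums differ in total by at least a
multiple of the square of the deviation of the column sums: this difference and the deviation are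
both compared with the variance of the square roots of the column sums. -/
lemma sq_colDev_le (D : Data m n d) (π : Plan m n) (hpos : ∀ l j, 0 < colSum π l j)
    (hrow : ∀ l i, ∑ j, π l i j = D.p l i) :
    colDev D π ^ 2 / 16 ≤ 1 - ∑ j, Real.exp (∑ l, D.w l * Real.log (colSum π l j)) := by
  set q : Fin m → Fin n → ℝ := fun l j => colSum π l j with hq
  set r : Fin m → Fin n → ℝ := fun l j => Real.sqrt (q l j) with hr
  set s : Fin n → ℝ := fun j => ∑ l, D.w l * r l j with hs
  have hr2 : ∀ l j, r l j ^ 2 = q l j := fun l j => Real.sq_sqrt (hpos l j).le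
  have hrpos : ∀ l j, 0 < r l j := fun l j => Real.sqrt_pos.2 (hpos l j)
  have hs0 : ∀ j, 0 ≤ s j := fun j =>
    Finset.sum_nonneg fun l _ => mul_nonneg (D.w_nonneg l) (hrpos l j).le
  have hgeo : ∀ j, Real.exp (∑ l, D.w l * Real.log (q l j)) ≤ s j ^ 2 := fun j => by
    have h := Real.geom_mean_le_arith_mean_weighted Finset.univ D.w (fun l => r l j)
      (fun l _ => D.w_nonneg l) D.w_sum (fun l _ => (hrpos l j).le)
    have h2 : ∏ l, r l j ^ D.w l = Real.exp (∑ l, D.w l * Real.log (r l j)) := by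
      rw [Real.exp_sum]
      exact Finset.prod_congr rfl fun l _ => by rw [Real.rpow_def_of_pos (hrpos l j), mul_comm]
    rw [h2] at h
    have h3 : ∑ l, D.w l * Real.log (q l j) = 2 * ∑ l, D.w l * Real.log (r l j) := by
      rw [Finset.mul_sum]
      refine Finset.sum_congr rfl fun l _ => ?_
      rw [← hr2, Real.log_pow]
      push_cast
      ring
    rw [h3, two_mul, Real.exp_add, ← sq]
    exact pow_le_pow_left₀ (Real.exp_pos _).le h 2
  have hqsum : ∑ l, D.w l * ∑ j, r l j ^ 2 = 1 := by
    simp only [hr2, hq, sum_colSum D π hrow, mul_one, D.w_sum]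
  have hcross : ∑ l, D.w l * ∑ j, r l j * s j = ∑ j, s j ^ 2 := by
    simp only [Finset.mul_sum]
    rw [Finset.sum_comm]
    refine Finset.sum_congr rfl fun j _ => ?_
    rw [sq]
    nth_rewrite 2 [hs]
    simp only [Finset.sum_mul]
    exact Finset.sum_congr rfl fun l _ => by ring
  have hminus : ∑ l, D.w l * ∑ j, (r l j - s j) ^ 2 = 1 - ∑ j, s j ^ 2 := by
    have : ∀ l, D.w l * ∑ j, (r l j - s j) ^ 2 = D.w l * ∑ j, r l j ^ 2 -
        2 * (D.w l * ∑ j, r l j * s j) + D.w l * ∑ j, s j ^ 2 := fun l => by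
      have e : ∀ j, (r l j - s j) ^ 2 = r l j ^ 2 - 2 * (r l j * s j) + s j ^ 2 := fun j => by ring
      simp only [e, Finset.sum_add_distrib, Finset.sum_sub_distrib, ← Finset.mul_sum]
      ring
    simp only [this, Finset.sum_add_distrib, Finset.sum_sub_distrib, ← Finset.mul_sum, hqsum,
      hcross, ← Finset.sum_mul, D.w_sum]
    ring
  have hplus : ∑ l, D.w l * ∑ j, (r l j + s j) ^ 2 = 1 + 3 * ∑ j, s j ^ 2 := by
    have : ∀ l, D.w l * ∑ j, (r l j + s j) ^ 2 = D.w l * ∑ j, r l j ^ 2 +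
        2 * (D.w l * ∑ j, r l j * s j) + D.w l * ∑ j, s j ^ 2 := fun l => by
      have e : ∀ j, (r l j + s j) ^ 2 = r l j ^ 2 + 2 * (r l j * s j) + s j ^ 2 := fun j => by ring
      simp only [e, Finset.sum_add_distrib, ← Finset.mul_sum]
      ring
    simp only [this, Finset.sum_add_distrib, ← Finset.mul_sum, hqsum,
      hcross, ← Finset.sum_mul, D.w_sum]
    ring
  -- the deviation from the mean is at most twice the deviation from any other centre
  have hdev : colDev D π ≤ 2 * ∑ l, D.w l * ∑ j, |r l j ^ 2 - s j ^ 2| := by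
    have h1 : ∀ j, |s j ^ 2 - ∑ l', D.w l' * q l' j| ≤ ∑ l', D.w l' * |r l' j ^ 2 - s j ^ 2| :=
      fun j => by
        have : s j ^ 2 - ∑ l', D.w l' * q l' j = ∑ l', D.w l' * (s j ^ 2 - r l' j ^ 2) := by
          simp only [mul_sub, Finset.sum_sub_distrib, ← Finset.sum_mul, D.w_sum, one_mul, hr2]
        rw [this]
        refine (Finset.abs_sum_le_sum_abs _ _).trans (Finset.sum_le_sum fun l _ => ?_)
        rw [abs_mul, abs_of_nonneg (D.w_nonneg l), abs_sub_comm]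
    have h2 : colDev D π ≤ ∑ l, D.w l * ∑ j, (|r l j ^ 2 - s j ^ 2| +
        ∑ l', D.w l' * |r l' j ^ 2 - s j ^ 2|) := by
      refine Finset.sum_le_sum fun l _ => mul_le_mul_of_nonneg_left
        (Finset.sum_le_sum fun j _ => ?_) (D.w_nonneg l)
      rw [hr2]
      exact (abs_sub_le _ (s j ^ 2) _).trans (add_le_add le_rfl (h1 j))
    refine h2.trans (le_of_eq ?_)
    simp only [Finset.sum_add_distrib, mul_add, ← Finset.sum_mul, D.w_sum, one_mul]
    rw [two_mul]
    congr 1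
    rw [Finset.sum_comm]
    simp only [Finset.mul_sum]
  have hcs := sq_sum_abs_sq_sub_sq_le (Finset.univ ×ˢ Finset.univ)
    (fun t : Fin m × Fin n => D.w t.1) (fun t => r t.1 t.2) (fun t => s t.2)
    (fun t _ => D.w_nonneg t.1)
  simp only [Finset.sum_product, ← Finset.mul_sum, hminus, hplus] at hcs
  have hdev0 : 0 ≤ colDev D π := Finset.sum_nonneg fun l _ =>
    mul_nonneg (D.w_nonneg l) (Finset.sum_nonneg fun j _ => abs_nonneg _)
  have hgs := Finset.sum_le_sum fun j (_ : j ∈ Finset.univ) => hgeo j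
  have hs1 : 0 ≤ 1 - ∑ j, s j ^ 2 := by
    rw [← hminus]
    exact Finset.sum_nonneg fun l _ => mul_nonneg (D.w_nonneg l)
      (Finset.sum_nonneg fun j _ => sq_nonneg _)
  have h4 := pow_le_pow_left₀ hdev0 hdev 2
  change colDev D π ^ 2 / 16 ≤ 1 - ∑ j, Real.exp (∑ l, D.w l * Real.log (q l j))
  nlinarith

/-! ### The plans of the IBP iteration -/

variable [NeZero n]

lemma gibbs_updateU (D : Data m n d) (U : Matrix (Fin d) (Fin k) ℝ) (η : ℝ)
    (u v : Fin m → Fin n → ℝ) :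
    gibbs D U η (updateU D U η u v) v = softPlan D (expo D U η v) := by
  ext l i j
  rw [softPlan_apply]
  by_cases hp : D.p l i = 0
  · simp [gibbs, hp]
  have hp' : 0 < D.p l i := lt_of_le_of_ne (D.p_nonneg l i) (Ne.symm hp)
  have hS := sum_exp_pos (expo D U η v l i)
  have hrow : ∑ j, gibbs D U η u v l i j =
      Real.exp (u l i) * ∑ j, Real.exp (expo D U η v l i j) := by
    rw [Finset.mul_sum]
    refine Finset.sum_congr rfl fun j _ => ?_
    simp only [gibbs, Matrix.of_apply, if_neg hp, expo]
    rw [← Real.exp_add]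
    congr 1
    ring
  have hg : gibbs D U η (updateU D U η u v) v l i j =
      Real.exp (expo D U η v l i j) * Real.exp (u l i) *
        (D.p l i / ∑ j, gibbs D U η u v l i j) := by
    have hpos : 0 < D.p l i / ∑ j, gibbs D U η u v l i j := by
      rw [hrow]
      positivity
    rw [← Real.exp_log hpos, ← Real.exp_add, ← Real.exp_add]
    simp only [gibbs, Matrix.of_apply, if_neg hp, expo, updateU]
    congr 1
    ring
  rw [hg, hrow, softmax]
  have := Real.exp_pos (u l i)
  field_simp

/-- The plans of the IBP iteration are the gradients of `wlse` at the current exponents. -/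
lemma ibpPlan_eq (D : Data m n d) (U : Matrix (Fin d) (Fin k) ℝ) (η : ℝ)
    (init : (Fin m → Fin n → ℝ) × (Fin m → Fin n → ℝ)) (s : ℕ) :
    ibpPlan D U η init s = softPlan D (expo D U η (ibpIter D U η init (s + 1)).2) :=
  gibbs_updateU D U η _ _

/-! ### Termination of the IBP solver -/

/-- One iteration of IBP decreases `wlse`. -/
lemma wlse_ibpIter_succ_le (D : Data m n d) (U : Matrix (Fin d) (Fin k) ℝ) (η : ℝ)
    (init : (Fin m → Fin n → ℝ) × (Fin m → Fin n → ℝ)) (s : ℕ) :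
    wlse D (expo D U η (ibpIter D U η init (s + 2)).2) ≤
      wlse D (expo D U η (ibpIter D U η init (s + 1)).2) -
        colDev D (ibpPlan D U η init s) ^ 2 / 16 := by
  set π := ibpPlan D U η init s with hπ
  set v := (ibpIter D U η init (s + 1)).2 with hv
  set A := expo D U η v with hA
  have hπA : π = softPlan D A := ibpPlan_eq D U η init s
  have hpos : ∀ l j, 0 < colSum π l j := fun l j => by
    rw [hπA]
    exact colSum_softPlan_pos D A l j
  have hrow : ∀ l i, ∑ j, π l i j = D.p l i := fun l i => by
    rw [hπA]
    exact sum_softPlan D A l i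
  set g : Fin n → ℝ := fun j => ∑ l, D.w l * Real.log (colSum π l j) with hg
  have hv2 : ∀ l j, (ibpIter D U η init (s + 2)).2 l j = v l j +
      (g j - Real.log (colSum π l j)) := fun l j => updateV_eq D U η _ _ l j
  set A' := expo D U η (ibpIter D U η init (s + 2)).2 with hA'
  have hA2 : ∀ l i j, A' l i j = A l i j + (g j - Real.log (colSum π l j)) := fun l i j => by
    rw [hA', expo, hv2, hA, expo]
    ring
  have hstep : ∀ l i, lse (A' l i) ≤ lse (A l i) +
      (∑ j, softmax (A l i) j * (Real.exp (g j) / colSum π l j) + (-1)) := fun l i => by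
    have hS := sum_exp_pos (A l i)
    have e : ∑ j, softmax (A l i) j * (Real.exp (g j) / colSum π l j) =
        (∑ j, Real.exp (A' l i j)) / ∑ j, Real.exp (A l i j) := by
      rw [Finset.sum_div]
      refine Finset.sum_congr rfl fun j _ => ?_
      rw [hA2, Real.exp_add, Real.exp_sub, Real.exp_log (hpos l j), softmax]
      ring
    rw [e]
    have := Real.log_le_sub_one_of_pos (div_pos (sum_exp_pos (A' l i)) hS)
    rw [Real.log_div (sum_exp_pos (A' l i)).ne' hS.ne'] at this
    simp only [lse]
    linarith
  have h1 := wp_mono D hstep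
  rw [wp_add, wp_add, sum_w_mul_sum_p, ← wdot_softPlan, ← hπA,
    wdot_col D π fun l j => Real.exp (g j) / colSum π l j] at h1
  have h2 : ∑ l, D.w l * ∑ j, colSum π l j * (Real.exp (g j) / colSum π l j) =
      ∑ j, Real.exp (g j) := by
    have : ∀ l, ∑ j, colSum π l j * (Real.exp (g j) / colSum π l j) = ∑ j, Real.exp (g j) :=
      fun l => Finset.sum_congr rfl fun j _ => mul_div_cancel₀ _ (hpos l j).ne'
    simp only [this, ← Finset.sum_mul, D.w_sum, one_mul]
  rw [h2] at h1
  have h3 := sq_colDev_le D π hpos hrow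
  simp only [wlse]
  linarith

lemma neg_le_wlse_expo (D : Data m n d) {U : Matrix (Fin d) (Fin k) ℝ} (hU : U ∈ stiefel d k)
    {η : ℝ} (hη : 0 < η) {v : Fin m → Fin n → ℝ} (hv : ∀ j, ∑ l, D.w l * v l j = 0) :
    -(cbar D / η) ≤ wlse D (expo D U η v) := by
  obtain ⟨π, hπ⟩ := exists_mem_feasible D
  refine le_trans ?_ (wdot_le_wlse D π hπ.1 hπ.2.1 _)
  rw [expo_eq, wdot_add_right, wdot_potential_of_feasible D hπ hv, wdot_smul_right, add_zero]
  have h := abs_wdot_le D π (projCost D U) (B := cbar D) fun l i j => by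
    rw [abs_of_nonneg (projCost_nonneg D U l i j)]
    exact projCost_le_cbar D hU l i j
  rw [wnorm_eq_one_of_feasible D hπ, mul_one] at h
  have h2 := mul_le_mul_of_nonneg_left (abs_le.1 h).2 (inv_nonneg.2 hη.le)
  rw [div_eq_mul_inv, mul_comm (cbar D)]
  linarith

/-- IBP passes every positive tolerance. -/
lemma exists_colDev_ibpPlan_le (D : Data m n d) {U : Matrix (Fin d) (Fin k) ℝ}
    (hU : U ∈ stiefel d k) {η : ℝ} (hη : 0 < η)
    (init : (Fin m → Fin n → ℝ) × (Fin m → Fin n → ℝ))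
    (hinit : ∀ j, ∑ l, D.w l * init.2 l j = 0) {δ : ℝ} (hδ : 0 < δ) :
    ∃ s, colDev D (ibpPlan D U η init s) ≤ δ := by
  by_contra! h
  set a : ℕ → ℝ := fun s => wlse D (expo D U η (ibpIter D U η init (s + 1)).2) with ha
  have hstep : ∀ s : ℕ, a s ≤ a 0 - s * (δ ^ 2 / 16) := fun s => by
    induction s with
    | zero => simp
    | succ s ih =>
      have h1 := wlse_ibpIter_succ_le D U η init s
      have h2 := pow_le_pow_left₀ hδ.le (h s).le 2
      have h3 : a (s + 1) ≤ a s - δ ^ 2 / 16 := by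
        simp only [ha]
        linarith
      push_cast
      linarith
  obtain ⟨N, hN⟩ := exists_nat_gt ((a 0 + cbar D / η) / (δ ^ 2 / 16))
  rw [div_lt_iff₀ (by positivity)] at hN
  have h1 := hstep N
  have h2 := neg_le_wlse_expo D hU hη (sum_w_mul_ibpIter D U η init hinit (N + 1))
  simp only [ha] at h1 hN
  linarith

end

section

/-! ### Constants of a retraction -/

/-- The first order Taylor remainder of a `C²` map is quadratic, uniformly on a ball. -/
lemma exists_norm_sub_sub_deriv_le {V W : Type*} [NormedAddCommGroup V] [NormedSpace ℝ V]
    [FiniteDimensional ℝ V] [NormedAddCommGroup W] [NormedSpace ℝ W] {F : V → W}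
    (hF : ContDiff ℝ 2 F) (r : ℝ) :
    ∃ M : ℝ, 0 ≤ M ∧ ∀ x ∈ Metric.closedBall (0 : V) r, ∀ y ∈ Metric.closedBall (0 : V) r,
      ∀ w : W, Filter.Tendsto (fun t : ℝ => ‖t⁻¹ • (F (x + t • (y - x)) - F x) - w‖)
        (𝓝[≠] 0) (𝓝 0) →
        ‖F y - F x - w‖ ≤ M * ‖y - x‖ ^ 2 := by
  have hG : ContDiff ℝ 1 (fderiv ℝ F) := hF.fderiv_right (by norm_num)
  have : ProperSpace V := FiniteDimensional.proper ℝ _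
  obtain ⟨M, hM⟩ := hG.contDiffOn.exists_lipschitzOnWith one_ne_zero
    (convex_closedBall (0 : V) r) (isCompact_closedBall _ _)
  refine ⟨M, M.2, fun x hx y hy w hw => ?_⟩
  have hw' : w = fderiv ℝ F x (y - x) := by
    have hline : HasDerivAt (fun t : ℝ => x + t • (y - x)) (y - x) 0 := by
      simpa using ((hasDerivAt_id (0 : ℝ)).smul_const (y - x)).const_add x
    have hF0 : HasFDerivAt F (fderiv ℝ F x) (x + (0 : ℝ) • (y - x)) := by
      rw [zero_smul, add_zero]
      exact (hF.differentiable two_ne_zero x).hasFDerivAt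
    have hw0 : HasDerivAt (fun t : ℝ => F (x + t • (y - x))) w 0 := by
      rw [hasDerivAt_iff_tendsto_slope, tendsto_iff_norm_sub_tendsto_zero]
      simpa [slope_def_module] using hw
    exact hw0.unique (hF0.comp_hasDerivAt (0 : ℝ) hline)
  rw [hw']
  have h := Convex.norm_image_sub_le_of_norm_hasFDerivWithin_le'
    (s := Metric.closedBall 0 r ∩ Metric.closedBall x ‖y - x‖) (f := F) (f' := fderiv ℝ F)
    (φ := fderiv ℝ F x) (C := M * ‖y - x‖) (x := x) (y := y)
    (fun z _ => (hF.differentiable two_ne_zero z).hasFDerivAt.hasFDerivWithinAt)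
    (fun z hz => by
      refine (hM.norm_sub_le hz.1 hx).trans ?_
      have := mem_closedBall_iff_norm.1 hz.2
      gcongr)
    ((convex_closedBall _ _).inter (convex_closedBall _ _))
    ⟨hx, Metric.mem_closedBall_self (norm_nonneg _)⟩ ⟨hy, mem_closedBall_iff_norm.2 le_rfl⟩
  rwa [sq, ← mul_assoc]

section RetractionConst

variable {d k : ℕ}
  {Retr : Matrix (Fin d) (Fin k) ℝ → Matrix (Fin d) (Fin k) ℝ → Matrix (Fin d) (Fin k) ℝ}

lemma norm_of_mem_stiefel {U : Matrix (Fin d) (Fin k) ℝ} (hU : U ∈ stiefel d k) :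
    ‖U‖ = Real.sqrt k := by
  have hU' : Uᵀ * U = 1 := hU
  have h : ‖U‖ ^ 2 = k := by
    rw [← real_inner_self_eq_norm_sq, frobenius_inner_def, hU', Matrix.trace_one,
      Fintype.card_fin]
  rw [← h, Real.sqrt_sq (norm_nonneg _)]

/-- The tangent vector `ξ` is the derivative of `t ↦ Retr U (t • ξ)` at `0`. -/
lemma IsRetraction.tendsto_slope (hR : IsRetraction Retr) {U ξ : Matrix (Fin d) (Fin k) ℝ}
    (hU : U ∈ stiefel d k) (hξ : ξ ∈ tangentSpace U) :
    Filter.Tendsto (fun t : ℝ => ‖t⁻¹ • (Retr U (t • ξ) - U) - ξ‖) (𝓝[≠] 0) (𝓝 0) := by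
  rcases eq_or_ne ξ 0 with rfl | hne
  · simp [hR.zero U hU]
  have hto : Filter.Tendsto (fun t : ℝ => t • ξ) (𝓝[≠] 0)
      (𝓝[(tangentSpace U : Set (Matrix (Fin d) (Fin k) ℝ)) \ {0}] 0) := by
    refine tendsto_nhdsWithin_iff.2 ⟨?_, ?_⟩
    · refine Filter.Tendsto.mono_left ?_ nhdsWithin_le_nhds
      exact Continuous.tendsto' (by fun_prop) _ _ (zero_smul _ _)
    · filter_upwards [self_mem_nhdsWithin] with t ht
      exact ⟨(tangentSpace U).smul_mem t hξ, smul_ne_zero ht hne⟩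
  have h2 := ((hR.first_order U hU).comp hto).mul_const ‖ξ‖
  rw [zero_mul] at h2
  refine h2.congr' ?_
  filter_upwards [self_mem_nhdsWithin] with t ht
  have ht' : t ≠ 0 := ht
  have hξ' : ‖ξ‖ ≠ 0 := norm_ne_zero_iff.2 hne
  have e : t⁻¹ • (Retr U (t • ξ) - U) - ξ = t⁻¹ • (Retr U (t • ξ) - (U + t • ξ)) := by
    rw [← sub_sub, smul_sub _ _ (t • ξ),
      smul_smul, inv_mul_cancel₀ ht', one_smul]
  rw [e, norm_smul, norm_inv, Function.comp_apply, norm_smul]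
  field_simp

/-- Every retraction has constants `L₁` and `L₂`: for short tangent vectors by Taylor's formula on
a compact set, for long ones because the Stiefel manifold is bounded. -/
lemma IsRetraction.exists_isRetractionConst (hR : IsRetraction Retr) :
    ∃ L₁ L₂ : ℝ, IsRetractionConst Retr L₁ L₂ := by
  obtain ⟨F, hF, hFR⟩ := hR.smooth
  have hk : 0 ≤ Real.sqrt k := Real.sqrt_nonneg _
  obtain ⟨M, hM0, hM⟩ := exists_norm_sub_sub_deriv_le (hF.of_le (by norm_cast)) (Real.sqrt k + 1)
  have hshort : ∀ U ∈ stiefel d k, ∀ ξ ∈ tangentSpace U, ‖ξ‖ ≤ 1 →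
      ‖Retr U ξ - (U + ξ)‖ ≤ M * ‖ξ‖ ^ 2 := by
    intro U hU ξ hξ h1
    have hx : (U, (0 : Matrix (Fin d) (Fin k) ℝ)) ∈ Metric.closedBall 0 (Real.sqrt k + 1) := by
      rw [mem_closedBall_zero_iff, Prod.norm_def, norm_zero, norm_of_mem_stiefel hU]
      exact max_le (by linarith) (by linarith)
    have hy : (U, ξ) ∈ Metric.closedBall 0 (Real.sqrt k + 1) := by
      rw [mem_closedBall_zero_iff, Prod.norm_def, norm_of_mem_stiefel hU]
      exact max_le (by linarith) (by linarith)
    have hyx : (U, ξ) - (U, (0 : Matrix (Fin d) (Fin k) ℝ)) = (0, ξ) := by simp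
    have hn : ‖((0 : Matrix (Fin d) (Fin k) ℝ), ξ)‖ = ‖ξ‖ := by simp [Prod.norm_def]
    have hd : Filter.Tendsto (fun t : ℝ => ‖t⁻¹ • (F ((U, 0) + t • ((U, ξ) - (U, 0))) - F (U, 0))
        - ξ‖) (𝓝[≠] 0) (𝓝 0) := by
      refine (hR.tendsto_slope hU hξ).congr fun t => ?_
      have e : (U, (0 : Matrix (Fin d) (Fin k) ℝ)) + t • ((U, ξ) - (U, 0)) = (U, t • ξ) := by
        simp
      rw [e, hFR U hU _ ((tangentSpace U).smul_mem t hξ), hFR U hU 0 (tangentSpace U).zero_mem,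
        hR.zero U hU]
    have h := hM _ hx _ hy ξ hd
    rw [hyx, hn, hFR U hU ξ hξ, hFR U hU 0 (tangentSpace U).zero_mem, hR.zero U hU, sub_sub] at h
    exact h
  have hb2 : ∀ U ∈ stiefel d k, ∀ ξ ∈ tangentSpace U,
      ‖Retr U ξ - (U + ξ)‖ ≤ (M + 2 * Real.sqrt k + 1) * ‖ξ‖ ^ 2 := by
    intro U hU ξ hξ
    rcases le_total ‖ξ‖ 1 with h1 | h1
    · refine (hshort U hU ξ hξ h1).trans ?_
      gcongr
      linarith
    · have h2 : ‖Retr U ξ - (U + ξ)‖ ≤ Real.sqrt k + (Real.sqrt k + ‖ξ‖) := by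
        refine (norm_sub_le _ _).trans ?_
        rw [norm_of_mem_stiefel (hR.mapsTo U hU ξ hξ)]
        refine add_le_add le_rfl ((norm_add_le _ _).trans ?_)
        rw [norm_of_mem_stiefel hU]
      have h3 : 0 ≤ (2 * Real.sqrt k) * (‖ξ‖ ^ 2 - 1) :=
        mul_nonneg (by positivity) (by nlinarith)
      nlinarith [mul_nonneg hM0 (sq_nonneg ‖ξ‖)]
  refine ⟨1 + (M + 2 * Real.sqrt k + 1), M + 2 * Real.sqrt k + 1, by positivity, by positivity,
    fun U hU ξ hξ => ?_, hb2⟩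
  rcases le_total ‖ξ‖ 1 with h1 | h1
  · have h2 : Retr U ξ - U = (Retr U ξ - (U + ξ)) + ξ := by abel
    rw [h2]
    refine (norm_add_le _ _).trans ?_
    have h3 := hb2 U hU ξ hξ
    have h4 : ‖ξ‖ ^ 2 ≤ ‖ξ‖ := by nlinarith [norm_nonneg ξ]
    have h5 : (M + 2 * Real.sqrt k + 1) * ‖ξ‖ ^ 2 ≤ (M + 2 * Real.sqrt k + 1) * ‖ξ‖ := by gcongr
    linarith
  · refine (norm_sub_le _ _).trans ?_
    rw [norm_of_mem_stiefel (hR.mapsTo U hU ξ hξ), norm_of_mem_stiefel hU]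
    nlinarith

/-- `L₁ ≥ 1` as soon as some tangent space is nontrivial. -/
lemma IsRetractionConst.one_le {L₁ L₂ : ℝ} (hL : IsRetractionConst Retr L₁ L₂)
    {U ξ : Matrix (Fin d) (Fin k) ℝ} (hU : U ∈ stiefel d k) (hξ : ξ ∈ tangentSpace U)
    (hne : ξ ≠ 0) : 1 ≤ L₁ := by
  have hpos : 0 < ‖ξ‖ := norm_pos_iff.2 hne
  have key : ∀ t : ℝ, 0 < t → 1 ≤ L₁ + t * (L₂ * ‖ξ‖) := fun t ht => by
    have hmem := (tangentSpace U).smul_mem t hξ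
    have h1 := hL.bound₁ U hU _ hmem
    have h2 := hL.bound₂ U hU _ hmem
    have h3 : t • ξ = (Retr U (t • ξ) - U) - (Retr U (t • ξ) - (U + t • ξ)) := by abel
    have h4 := norm_sub_le (Retr U (t • ξ) - U) (Retr U (t • ξ) - (U + t • ξ))
    rw [← h3] at h4
    rw [norm_smul, Real.norm_of_nonneg ht.le] at h1 h2 h4
    have h5 : t * ‖ξ‖ * 1 ≤ t * ‖ξ‖ * (L₁ + t * (L₂ * ‖ξ‖)) := by nlinarith
    exact le_of_mul_le_mul_left h5 (by positivity)
  by_contra! h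
  have hc : 0 < L₂ * ‖ξ‖ := mul_pos hL.pos₂ hpos
  have h2 := key ((1 - L₁) / (2 * (L₂ * ‖ξ‖))) (by
    have : 0 < 1 - L₁ := by linarith
    positivity)
  have h3 : (1 - L₁) / (2 * (L₂ * ‖ξ‖)) * (L₂ * ‖ξ‖) = (1 - L₁) / 2 := by
    have := hc.ne'
    generalize L₂ * ‖ξ‖ = c at *
    field_simp
  rw [h3] at h2
  linarith

end RetractionConst

end

section

/-! ### Potentials and the regularized dual value -/

variable {m n d k : ℕ}

/-- Potentials `v` with `∑ l, w l * v l = 0` whose oscillation is at most `2 c̄ / η`. All iterates of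
IBP but the initial one are of this kind, at every point of the Stiefel manifold. -/
def potentials (D : Data m n d) (η : ℝ) : Set (Fin m → Fin n → ℝ) :=
  {v | (∀ j, ∑ l, D.w l * v l j = 0) ∧ ∀ l j j', v l j - v l j' ≤ 2 * cbar D / η}

/-- The dual value of the entropic problem `min_{π ∈ Π(p)} f(π, U) - η * entropy`. The supremum is
restricted to `potentials D η`, where the gap to a given potential is controlled by the stopping
criterion of IBP. -/
noncomputable def dualVal (D : Data m n d) (η : ℝ) (U : Matrix (Fin d) (Fin k) ℝ) : ℝ :=
  ⨆ v : potentials D η, -(η * wlse D (expo D U η v))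

/-- On a plan with row sums `p`, the pairing with a potential measures the deviation of the column
sums. -/
lemma abs_wdot_potential_le (D : Data m n d) {η : ℝ} {v : Fin m → Fin n → ℝ}
    (hv : v ∈ potentials D η) {π : Plan m n} (hrow : ∀ l i, ∑ j, π l i j = D.p l i) :
    |wdot D π (fun l _ j => v l j)| ≤ cbar D / η * colDev D π := by
  set b : Fin n → ℝ := fun j => ∑ l, D.w l * colSum π l j with hb
  have hbsum : ∑ j, b j = 1 := by
    simp only [hb]
    rw [Finset.sum_comm]
    simp only [← Finset.mul_sum, sum_colSum D π hrow, mul_one, D.w_sum]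
  -- centring every `v l` at the midpoint of its range halves the bound on its size
  have hmid : ∀ l, ∃ c, ∀ j, |v l j - c| ≤ cbar D / η := fun l => by
    rcases isEmpty_or_nonempty (Fin n) with h | h
    · exact ⟨0, fun j => h.elim j⟩
    obtain ⟨a, ha⟩ := Finite.exists_max (v l)
    obtain ⟨a', ha'⟩ := Finite.exists_min (v l)
    refine ⟨(v l a + v l a') / 2, fun j => abs_le.2 ?_⟩
    have h1 := hv.2 l a a'
    have h2 : 2 * cbar D / η = cbar D / η + cbar D / η := by ring
    constructor <;> linarith [ha j, ha' j]
  choose c hc using hmid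
  have hcentre : wdot D π (fun l _ j => v l j) =
      ∑ l, D.w l * ∑ j, (colSum π l j - b j) * (v l j - c l) := by
    have e : ∀ l, ∑ j, (colSum π l j - b j) * (v l j - c l) =
        ∑ j, colSum π l j * v l j - ∑ j, b j * v l j := fun l => by
      simp only [sub_mul, mul_sub, Finset.sum_sub_distrib, ← Finset.sum_mul,
        sum_colSum D π hrow, hbsum]
      ring
    have e0 : ∑ l, D.w l * ∑ j, b j * v l j = 0 := by
      simp only [Finset.mul_sum]
      rw [Finset.sum_comm]
      refine Finset.sum_eq_zero fun j _ => ?_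
      rw [← mul_zero (b j), ← hv.1 j, Finset.mul_sum]
      exact Finset.sum_congr rfl fun l _ => by ring
    simp only [wdot_col, e, mul_sub (D.w _), Finset.sum_sub_distrib (f := fun l => D.w l * _), e0,
      sub_zero]
  rw [hcentre, colDev, Finset.mul_sum]
  refine (Finset.abs_sum_le_sum_abs _ _).trans (Finset.sum_le_sum fun l _ => ?_)
  rw [abs_mul, abs_of_nonneg (D.w_nonneg l), mul_left_comm]
  refine mul_le_mul_of_nonneg_left ?_ (D.w_nonneg l)
  rw [Finset.mul_sum]
  refine (Finset.abs_sum_le_sum_abs _ _).trans (Finset.sum_le_sum fun j _ => ?_)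
  rw [abs_mul, mul_comm]
  exact mul_le_mul_of_nonneg_right (hc l j) (abs_nonneg _)

lemma zero_mem_potentials (D : Data m n d) {η : ℝ} (hη : 0 < η) :
    (0 : Fin m → Fin n → ℝ) ∈ potentials D η := by
  refine ⟨by simp, fun l j j' => ?_⟩
  have := cbar_nonneg D
  simp only [Pi.zero_apply, sub_zero]
  positivity

lemma wdot_expo_sub (D : Data m n d) (U : Matrix (Fin d) (Fin k) ℝ) (η : ℝ) (π : Plan m n)
    (v v' : Fin m → Fin n → ℝ) :
    wdot D π (expo D U η v - expo D U η v') =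
      wdot D π (fun l _ j => v l j) - wdot D π (fun l _ j => v' l j) := by
  rw [wdot_sub_right, expo_eq, expo_eq, wdot_add_right, wdot_add_right]
  ring

lemma ibpIter_mem_potentials (D : Data m n d) {U : Matrix (Fin d) (Fin k) ℝ}
    (hU : U ∈ stiefel d k) {η : ℝ} (hη : 0 < η)
    (init : (Fin m → Fin n → ℝ) × (Fin m → Fin n → ℝ))
    (hinit : ∀ j, ∑ l, D.w l * init.2 l j = 0) (s : ℕ) :
    (ibpIter D U η init (s + 1)).2 ∈ potentials D η :=
  ⟨sum_w_mul_ibpIter D U η init hinit (s + 1), ibpIter_sub_le D hU hη init hinit s⟩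

variable [NeZero n]

lemma neg_wlse_expo_le_cbar (D : Data m n d) {U : Matrix (Fin d) (Fin k) ℝ} (hU : U ∈ stiefel d k)
    {η : ℝ} (hη : 0 < η) (v : potentials D η) : -(η * wlse D (expo D U η v)) ≤ cbar D := by
  have h := neg_le_wlse_expo D hU hη v.2.1
  have h2 := mul_le_mul_of_nonneg_left h hη.le
  rw [mul_neg, mul_div_cancel₀ _ hη.ne'] at h2
  linarith

lemma le_dualVal (D : Data m n d) {U : Matrix (Fin d) (Fin k) ℝ} (hU : U ∈ stiefel d k)
    {η : ℝ} (hη : 0 < η) {v : Fin m → Fin n → ℝ} (hv : v ∈ potentials D η) :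
    -(η * wlse D (expo D U η v)) ≤ dualVal D η U :=
  le_ciSup (f := fun v : potentials D η => -(η * wlse D (expo D U η v)))
    ⟨cbar D, Set.forall_mem_range.2 (neg_wlse_expo_le_cbar D hU hη)⟩ ⟨v, hv⟩

lemma dualVal_le_cbar (D : Data m n d) {U : Matrix (Fin d) (Fin k) ℝ} (hU : U ∈ stiefel d k)
    {η : ℝ} (hη : 0 < η) : dualVal D η U ≤ cbar D :=
  have : Nonempty (potentials D η) := ⟨⟨0, zero_mem_potentials D hη⟩⟩
  ciSup_le (neg_wlse_expo_le_cbar D hU hη)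

lemma neg_le_dualVal (D : Data m n d) {U : Matrix (Fin d) (Fin k) ℝ} (hU : U ∈ stiefel d k)
    {η : ℝ} (hη : 0 < η) : -(η * Real.log n) ≤ dualVal D η U := by
  refine le_trans ?_ (le_dualVal D hU hη (zero_mem_potentials D hη))
  have h1 := wlse_le_log_add D (expo D U η 0)
  have h2 : wdot D (softPlan D (expo D U η 0)) (expo D U η 0) ≤
      wdot D (softPlan D (expo D U η 0)) (fun _ _ _ => 0) :=
    wdot_mono D _ (softPlan_nonneg D _) fun l i j => by
      have := div_nonneg (projCost_nonneg D U l i j) hη.le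
      simp only [expo, Pi.zero_apply, add_zero, neg_div]
      linarith
  have h3 : wdot D (softPlan D (expo D U η 0)) (fun _ _ _ => 0) = 0 := by simp [wdot]
  have h4 := mul_le_mul_of_nonneg_left (h1.trans (add_le_add le_rfl (h2.trans_eq h3))) hη.le
  linarith

/-- The duality gap of a potential is controlled by the deviation of the column sums, by convexity
of `wlse`. -/
lemma dualVal_le_add_colDev (D : Data m n d) (U : Matrix (Fin d) (Fin k) ℝ)
    {η : ℝ} (hη : 0 < η) {v : Fin m → Fin n → ℝ} (hv : v ∈ potentials D η) :
    dualVal D η U ≤ -(η * wlse D (expo D U η v)) +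
      2 * cbar D * colDev D (softPlan D (expo D U η v)) := by
  have : Nonempty (potentials D η) := ⟨⟨0, zero_mem_potentials D hη⟩⟩
  refine ciSup_le fun v' => ?_
  set P := softPlan D (expo D U η v) with hP
  have h1 := wlse_ge D (expo D U η v') (expo D U η v)
  rw [wdot_expo_sub, ← hP] at h1
  have h2 := abs_le.1 (abs_wdot_potential_le D hv (sum_softPlan D (expo D U η v)))
  have h3 := abs_le.1 (abs_wdot_potential_le D v'.2 (sum_softPlan D (expo D U η v)))
  rw [← hP] at h2 h3
  have h4 : wlse D (expo D U η v) - 2 * (cbar D / η * colDev D P) ≤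
      wlse D (expo D U η v') := by
    have := sq_nonneg (wnorm D (softPlan D (expo D U η v') - P))
    linarith
  have h5 := mul_le_mul_of_nonneg_left h4 hη.le
  have h6 : η * (wlse D (expo D U η v) - 2 * (cbar D / η * colDev D P)) =
      η * wlse D (expo D U η v) - 2 * cbar D * colDev D P := by
    field_simp
  linarith

/-- Two potentials whose plans have almost equal column sums have close plans. -/
lemma sq_wnorm_sub_le (D : Data m n d) (U : Matrix (Fin d) (Fin k) ℝ)
    {η : ℝ} {v v' : Fin m → Fin n → ℝ} (hv : v ∈ potentials D η) (hv' : v' ∈ potentials D η) :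
    wnorm D (softPlan D (expo D U η v) - softPlan D (expo D U η v')) ^ 2 ≤
      4 * (cbar D / η) * (colDev D (softPlan D (expo D U η v)) +
        colDev D (softPlan D (expo D U η v'))) := by
  have h := sq_wnorm_softPlan_sub_le D (expo D U η v) (expo D U η v')
  rw [wdot_expo_sub, wdot_expo_sub] at h
  have h1 := abs_le.1 (abs_wdot_potential_le D hv (sum_softPlan D (expo D U η v)))
  have h2 := abs_le.1 (abs_wdot_potential_le D hv' (sum_softPlan D (expo D U η v)))
  have h3 := abs_le.1 (abs_wdot_potential_le D hv (sum_softPlan D (expo D U η v')))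
  have h4 := abs_le.1 (abs_wdot_potential_le D hv' (sum_softPlan D (expo D U η v')))
  linarith

/-! ### The output of the IBP solver -/

lemma exists_mem_potentials_colDev_le (D : Data m n d) {U : Matrix (Fin d) (Fin k) ℝ}
    (hU : U ∈ stiefel d k) {η : ℝ} (hη : 0 < η) {δ : ℝ} (hδ : 0 < δ) :
    ∃ v ∈ potentials D η, colDev D (softPlan D (expo D U η v)) ≤ δ := by
  obtain ⟨s, hs⟩ := exists_colDev_ibpPlan_le D hU hη (0, 0) (by simp) hδ
  rw [ibpPlan_eq] at hs
  exact ⟨_, ibpIter_mem_potentials D hU hη _ (by simp) s, hs⟩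

/-- Rounding the plan of a potential costs no more than the deviation of its column sums. -/
lemma roundPlan_softPlan_spec (D : Data m n d) (A : Fin m → Fin n → Fin n → ℝ) :
    (fun l => roundPlan (softPlan D A l) (D.p l)
      fun j => ∑ l', D.w l' * colSum (softPlan D A) l' j) ∈ feasible D ∧
    wnorm D ((fun l => roundPlan (softPlan D A l) (D.p l)
      fun j => ∑ l', D.w l' * colSum (softPlan D A) l' j) - softPlan D A) ≤
        colDev D (softPlan D A) := by
  set P := softPlan D A with hP
  set b : Fin n → ℝ := fun j => ∑ l', D.w l' * colSum P l' j with hb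
  have hrow := sum_softPlan D A
  have hb0 : ∀ j, 0 ≤ b j := fun j => Finset.sum_nonneg fun l _ =>
    mul_nonneg (D.w_nonneg l) (colSum_softPlan_pos D A l j).le
  have hbsum : ∑ j, b j = 1 := by
    simp only [hb]
    rw [Finset.sum_comm]
    simp only [← Finset.mul_sum, sum_colSum D P hrow, mul_one, D.w_sum]
  have h := fun l => roundPlan_spec (P l) (D.p l) b (softPlan_nonneg D A l) (hrow l) hb0
    (colSum_softPlan_pos D A l) (by rw [D.p_sum, hbsum])
  refine ⟨⟨fun l => (h l).1, fun l => (h l).2.1, fun l l' j => ?_⟩, ?_⟩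
  · rw [(h l).2.2.1, (h l').2.2.1]
  · exact Finset.sum_le_sum fun l _ => mul_le_mul_of_nonneg_left (h l).2.2.2 (D.w_nonneg l)

/-- The solver terminates, with the rounding of the plan of a potential that passes the test. -/
lemma ibpSolver_spec (D : Data m n d) (hc : 0 < cbar D) {U : Matrix (Fin d) (Fin k) ℝ}
    (hU : U ∈ stiefel d k) {η ε : ℝ} (hη : 0 < η) (hε : 0 < ε)
    (init : (Fin m → Fin n → ℝ) × (Fin m → Fin n → ℝ))
    (hinit : ∀ j, ∑ l, D.w l * init.2 l j = 0) :
    ∃ R, ibpSolver D U η ε init = some R ∧ R ∈ feasible D ∧ ∃ v ∈ potentials D η,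
      colDev D (softPlan D (expo D U η v)) ≤ η * ε ^ 2 / (200 * cbar D ^ 3) ∧
      wnorm D (R - softPlan D (expo D U η v)) ≤ η * ε ^ 2 / (200 * cbar D ^ 3) := by
  classical
  have hex : ∃ s, ibpTest D U η ε init s :=
    exists_colDev_ibpPlan_le D hU hη init hinit (by positivity)
  have htest : colDev D _ ≤ _ := Nat.find_spec hex
  set s := Nat.find hex with hs
  rw [ibpPlan_eq] at htest
  have hspec := roundPlan_softPlan_spec D (expo D U η (ibpIter D U η init (s + 1)).2)
  rw [← ibpPlan_eq D U η init s] at hspec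
  refine ⟨fun l => roundPlan (ibpPlan D U η init s l) (D.p l) (ibpMean D U η init s), ?_,
    hspec.1, _, ibpIter_mem_potentials D hU hη init hinit s, htest, ?_⟩
  · rw [ibpSolver, dif_pos hex]
  · rw [← ibpPlan_eq] at htest ⊢
    exact hspec.2.trans htest

/-! ### Ascent of the dual value -/

/-- One step of the algorithm increases the dual value, unless the ascent direction is short. -/
lemma dualVal_ascent (D : Data m n d) (hc : 0 < cbar D)
    {Retr : Matrix (Fin d) (Fin k) ℝ → Matrix (Fin d) (Fin k) ℝ → Matrix (Fin d) (Fin k) ℝ}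
    (hR : IsRetraction Retr) {L₁ L₂ : ℝ} (hL : IsRetractionConst Retr L₁ L₂)
    {U : Matrix (Fin d) (Fin k) ℝ} (hU : U ∈ stiefel d k) {η ε τ : ℝ} (hη : 0 < η) (hε : 0 < ε)
    (hηε : 4 * η ≤ ε) (hτ : 0 < τ)
    (hτL : τ * (8 * L₂ * cbar D + 8 * cbar D ^ 2 / η * L₁ ^ 2) ≤ 1)
    {R : Plan m n} (hRf : R ∈ feasible D) {v : Fin m → Fin n → ℝ} (hv : v ∈ potentials D η)
    (hdev : colDev D (softPlan D (expo D U η v)) ≤ η * ε ^ 2 / (200 * cbar D ^ 3))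
    (hRv : wnorm D (R - softPlan D (expo D U η v)) ≤ η * ε ^ 2 / (200 * cbar D ^ 3))
    (hξε : ε < ‖ascentDir D R U‖) :
    dualVal D η U + τ * ε ^ 2 / 20 ≤ dualVal D η (Retr U (τ • ascentDir D R U)) := by
  set ξ := ascentDir D R U with hξ
  set δ := η * ε ^ 2 / (200 * cbar D ^ 3) with hδ
  have hδ0 : 0 < δ := by positivity
  have hξT : ξ ∈ tangentSpace U := ascentDir_mem D R U
  have hmem := (tangentSpace U).smul_mem τ hξT
  set U' := Retr U (τ • ξ) with hU'
  have hU's : U' ∈ stiefel d k := hR.mapsTo U hU _ hmem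
  have hεc : ε ≤ 2 * cbar D :=
    hξε.le.trans (norm_ascentDir_le D R hU (wnorm_eq_one_of_feasible D hRf))
  have hb1 := hL.bound₁ U hU _ hmem
  have hb2 := hL.bound₂ U hU _ hmem
  rw [norm_smul, Real.norm_of_nonneg hτ.le] at hb1 hb2
  rw [← hU'] at hb1 hb2
  have hL1 := hL.pos₁
  have hL2 := hL.pos₂
  refine le_of_forall_pos_le_add fun β hβ => ?_
  -- a potential whose duality gap is at most `β`
  obtain ⟨v', hv', hdev'⟩ := exists_mem_potentials_colDev_le D hU hη
    (lt_min hδ0 (show 0 < β / (2 * cbar D) by positivity))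
  have hdev1 := hdev'.trans (min_le_left _ _)
  have hdev2 := hdev'.trans (min_le_right _ _)
  rw [le_div_iff₀ (by positivity)] at hdev2
  set P := softPlan D (expo D U η v) with hP
  set Q := softPlan D (expo D U η v') with hQ
  have hgap := dualVal_le_add_colDev D U hη hv'
  have hQP : wnorm D (P - Q) ≤ ε / (5 * cbar D) := by
    refine le_of_sq_le_sq ((sq_wnorm_sub_le D U hv hv').trans ?_) (by positivity)
    calc 4 * (cbar D / η) * (colDev D P + colDev D Q) ≤ 4 * (cbar D / η) * (δ + δ) := by
          gcongr
      _ = (ε / (5 * cbar D)) ^ 2 := by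
          rw [hδ]
          field_simp
          ring
  have hQR : cbar D * wnorm D (Q - R) ≤ ε / 5 + ε / 200 := by
    have h1 : wnorm D (Q - R) ≤ ε / (5 * cbar D) + δ := by
      refine (wnorm_sub_le D Q P R).trans (add_le_add ?_ ?_)
      · rwa [wnorm_sub_comm]
      · rwa [wnorm_sub_comm]
    have h2 : cbar D * (ε / (5 * cbar D)) = ε / 5 := by field_simp
    have h3 : cbar D * δ ≤ ε / 200 := by
      have e : cbar D * δ = η * ε ^ 2 / cbar D ^ 2 / 200 := by
        rw [hδ]
        field_simp
      rw [e]
      refine div_le_div_of_nonneg_right ?_ (by norm_num)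
      rw [div_le_iff₀ (by positivity)]
      have h4 : ε ^ 2 ≤ 4 * cbar D ^ 2 := by nlinarith
      nlinarith [mul_le_mul_of_nonneg_left h4 hη.le, sq_nonneg (cbar D)]
    have h4 := mul_le_mul_of_nonneg_left h1 hc.le
    linarith
  -- smoothness of the dual function in the costs
  have hsm : wlse D (expo D U' η v') ≤ wlse D (expo D U η v') +
      -η⁻¹ * (wdot D Q (projCost D U') - wdot D Q (projCost D U)) +
      (2 * cbar D * ‖U' - U‖ / η) ^ 2 := by
    have hdiff : expo D U' η v' - expo D U η v' = (-η⁻¹) • (projCost D U' - projCost D U) := by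
      rw [expo_eq, expo_eq, smul_sub]
      abel
    have h := wlse_le_add_sq D (expo D U' η v') (expo D U η v') (M := 2 * cbar D * ‖U' - U‖ / η)
      fun l i j => by
        rw [hdiff, Pi.smul_apply, Pi.smul_apply, Pi.smul_apply, smul_eq_mul, abs_mul, abs_neg,
          abs_of_pos (inv_pos.2 hη), inv_mul_eq_div]
        have := abs_projCost_sub_le D hU hU's l i j
        simp only [Pi.sub_apply]
        gcongr
    rwa [hdiff, wdot_smul_right, wdot_sub_right] at h
  have hval := le_dualVal D hU's hη hv'
  -- the cost is convex in `U`
  have hconv : 2 * wdot D Q (projInner D U (U' - U)) ≤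
      wdot D Q (projCost D U') - wdot D Q (projCost D U) := by
    have h := projCost_add D U (U' - U)
    rw [add_sub_cancel] at h
    have h0 : wdot D Q (fun _ _ _ => 0) ≤ wdot D Q (projCost D (U' - U)) :=
      wdot_mono D Q (softPlan_nonneg D _) fun l i j => projCost_nonneg D _ l i j
    have h1 : wdot D Q (fun _ _ _ => 0) = 0 := by simp [wdot]
    rw [h, wdot_add_right, wdot_add_right, wdot_smul_right]
    linarith
  have hlin : wdot D Q (projInner D U (U' - U)) =
      τ * wdot D Q (projInner D U ξ) + wdot D Q (projInner D U (U' - (U + τ • ξ))) := by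
    have e : U' - U = τ • ξ + (U' - (U + τ • ξ)) := by abel
    rw [← inner_corr_mul, ← inner_corr_mul, ← inner_corr_mul, ← real_inner_smul_right,
      ← inner_add_right, ← e]
  have hr : -(cbar D * (L₂ * (τ * ‖ξ‖) ^ 2)) ≤
      wdot D Q (projInner D U (U' - (U + τ • ξ))) := by
    have h := abs_wdot_le D Q _
      (fun l i j => abs_projInner_le_of_mem_stiefel D hU (U' - (U + τ • ξ)) l i j)
    rw [wnorm_eq_one D Q (softPlan_nonneg D _) (sum_softPlan D _), mul_one] at h
    have h2 := mul_le_mul_of_nonneg_left hb2 hc.le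
    linarith [(abs_le.1 h).1]
  have hmain : ‖ξ‖ ^ 2 / 2 - (ε / 5 + ε / 200) * ‖ξ‖ ≤ wdot D Q (projInner D U ξ) := by
    have h := inner_ascentDir D R U ξ hξT
    rw [← hξ, real_inner_self_eq_norm_sq] at h
    have h2 := abs_wdot_le D (Q - R) _ (fun l i j => abs_projInner_le_of_mem_stiefel D hU ξ l i j)
    rw [wdot_sub_left] at h2
    have h3 := mul_le_mul_of_nonneg_right hQR (norm_nonneg ξ)
    linarith [(abs_le.1 h2).1]
  have hsq : η * (2 * cbar D * ‖U' - U‖ / η) ^ 2 ≤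
      4 * cbar D ^ 2 / η * L₁ ^ 2 * (τ * ‖ξ‖) ^ 2 := by
    calc η * (2 * cbar D * ‖U' - U‖ / η) ^ 2 = 4 * cbar D ^ 2 / η * ‖U' - U‖ ^ 2 := by
          field_simp
          ring
      _ ≤ 4 * cbar D ^ 2 / η * (L₁ * (τ * ‖ξ‖)) ^ 2 := by gcongr
      _ = _ := by ring
  have hsm' := mul_le_mul_of_nonneg_left hsm hη.le
  have e1 : η * (wlse D (expo D U η v') +
      -η⁻¹ * (wdot D Q (projCost D U') - wdot D Q (projCost D U)) +
      (2 * cbar D * ‖U' - U‖ / η) ^ 2) = η * wlse D (expo D U η v') -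
      (wdot D Q (projCost D U') - wdot D Q (projCost D U)) +
      η * (2 * cbar D * ‖U' - U‖ / η) ^ 2 := by
    field_simp
    ring
  rw [e1] at hsm'
  have hquad : (2 * (cbar D * L₂) + 4 * cbar D ^ 2 / η * L₁ ^ 2) * (τ * ‖ξ‖) ^ 2 ≤
      τ * ‖ξ‖ ^ 2 / 2 := by
    have h0 : 0 ≤ cbar D * L₂ := by positivity
    have h1 : τ * (2 * (cbar D * L₂) + 4 * cbar D ^ 2 / η * L₁ ^ 2) ≤ 1 / 2 := by
      have e : 8 * cbar D ^ 2 / η * L₁ ^ 2 = 2 * (4 * cbar D ^ 2 / η * L₁ ^ 2) := by ring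
      rw [e] at hτL
      linarith [mul_nonneg hτ.le h0]
    have h2 := mul_le_mul_of_nonneg_right h1 (show 0 ≤ τ * ‖ξ‖ ^ 2 by positivity)
    linarith
  have hτmain := mul_le_mul_of_nonneg_left hmain hτ.le
  have hfin : τ * ε ^ 2 / 20 ≤ 2 * (τ * (‖ξ‖ ^ 2 / 2 - (ε / 5 + ε / 200) * ‖ξ‖)) -
      τ * ‖ξ‖ ^ 2 / 2 := by
    have h1 : ε ^ 2 / 20 ≤ ‖ξ‖ ^ 2 / 2 - 2 * (ε / 5 + ε / 200) * ‖ξ‖ := by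
      have ha : ε * ‖ξ‖ ≤ ‖ξ‖ ^ 2 := by
        rw [sq]
        gcongr
      have hb : ε ^ 2 ≤ ‖ξ‖ ^ 2 := by gcongr
      linarith [sq_nonneg ‖ξ‖]
    have h2 := mul_le_mul_of_nonneg_left h1 hτ.le
    linarith
  linarith

/-! ### Suboptimality of the output -/

/-- The rounded plan is nearly optimal: the entropic regularization costs at most `η log n`, and
the remaining errors are controlled by the stopping test. -/
lemma objective_sub_le (D : Data m n d) (hc : 0 < cbar D)
    {U : Matrix (Fin d) (Fin k) ℝ} (hU : U ∈ stiefel d k) {η ε : ℝ} (hη : 0 < η) (hε : 0 < ε)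
    (hηε : 4 * η ≤ ε) (hηn : 4 * (η * Real.log n) ≤ ε)
    {R : Plan m n} (hRf : R ∈ feasible D) {v : Fin m → Fin n → ℝ} (hv : v ∈ potentials D η)
    (hdev : colDev D (softPlan D (expo D U η v)) ≤ η * ε ^ 2 / (200 * cbar D ^ 3))
    (hRv : wnorm D (R - softPlan D (expo D U η v)) ≤ η * ε ^ 2 / (200 * cbar D ^ 3))
    {σ : Plan m n} (hσ : σ ∈ feasible D) : objective D R U - objective D σ U ≤ ε := by
  have hcost : ∀ l i j, |projCost D U l i j| ≤ cbar D := fun l i j => by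
    rw [abs_of_nonneg (projCost_nonneg D U l i j)]
    exact projCost_le_cbar D hU l i j
  rw [objective_eq_wdot, objective_eq_wdot]
  rcases le_total (cbar D) ε with hcε | hcε
  · have h1 := (abs_le.1 (abs_wdot_le D R _ hcost)).2
    rw [wnorm_eq_one_of_feasible D hRf, mul_one] at h1
    have h2 : wdot D σ (fun _ _ _ => 0) ≤ wdot D σ (projCost D U) :=
      wdot_mono D σ hσ.1 fun l i j => projCost_nonneg D _ l i j
    have h3 : wdot D σ (fun _ _ _ => 0) = 0 := by simp [wdot]
    linarith
  set P := softPlan D (expo D U η v) with hP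
  set δ := η * ε ^ 2 / (200 * cbar D ^ 3) with hδ
  have hcδ : cbar D * δ ≤ ε / 800 := by
    have e : cbar D * δ = η * ε ^ 2 / cbar D ^ 2 / 200 := by
      rw [hδ]
      field_simp
    have h : η * ε ^ 2 / cbar D ^ 2 ≤ ε / 4 := by
      rw [div_le_iff₀ (by positivity)]
      have h4 : ε ^ 2 ≤ cbar D ^ 2 := by nlinarith
      nlinarith [mul_le_mul_of_nonneg_left h4 hη.le, sq_nonneg (cbar D)]
    rw [e]
    linarith
  have h1 := (abs_le.1 (abs_wdot_le D (R - P) _ hcost)).2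
  rw [wdot_sub_left] at h1
  have h1' := mul_le_mul_of_nonneg_left hRv hc.le
  have h2 := wlse_le_log_add D (expo D U η v)
  rw [← hP] at h2
  have h3 := wdot_le_wlse D σ hσ.1 hσ.2.1 (expo D U η v)
  have e1 : ∀ π : Plan m n, η * wdot D π (expo D U η v) =
      -wdot D π (projCost D U) + η * wdot D π (fun l _ j => v l j) := fun π => by
    rw [expo_eq, wdot_add_right, wdot_smul_right]
    field_simp
  have h4 := (abs_le.1 (abs_wdot_potential_le D hv (sum_softPlan D (expo D U η v)))).2
  rw [← hP] at h4
  have h5 : η * (cbar D / η * colDev D P) = cbar D * colDev D P := by field_simp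
  have h6 := mul_le_mul_of_nonneg_left hdev hc.le
  have h7 := mul_le_mul_of_nonneg_left (h3.trans h2) hη.le
  rw [mul_add, e1, e1, wdot_potential_of_feasible D hσ hv.1] at h7
  have h8 := mul_le_mul_of_nonneg_left h4 hη.le
  linarith

end

section

/-! ### The iteration count -/

/-- The elementary estimates behind the iteration bound. The hypothesis `hT` is what the ascent of
the dual value, by at least `τ ε² / 20` in each step, gives for a total increase of `2 c̄`. -/
lemma count_le {T c ε L₁ L₂ τ η Λ K : ℝ} (hc : 0 < c) (hε : 0 < ε) (hεc : ε ≤ 2 * c)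
    (hL₁ : 1 ≤ L₁) (hL₂ : 0 < L₂) (hΛ : 0.69 ≤ Λ) (hK : 1 ≤ K)
    (hη : η = ε / (4 * Λ + 2))
    (hτ : τ = 1 / (8 * L₂ * c + 2 * (2 * c + 4 * c ^ 2 / η) * L₁ ^ 2))
    (hT : T * (τ * ε ^ 2 / 20) ≤ 2 * c) :
    T ≤ 20000 * (1 + L₂) * (Λ ^ 2 * L₁ ^ 2 * c ^ 4 * K / ε ^ 4) ∧
    (L₂ * ε ≤ L₁ ^ 2 * c → T ≤ 20000 * (Λ ^ 2 * L₁ ^ 2 * c ^ 4 * K / ε ^ 4)) := by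
  have hΛ0 : 0 < Λ := by linarith
  have hL₁0 : 0 < L₁ := by linarith
  have hL1sq : 1 ≤ L₁ ^ 2 := one_le_pow₀ hL₁
  set r : ℝ := c / ε with hr
  have hr0 : 0 < r := by positivity
  have hr1 : 1 / 2 ≤ r := by
    rw [hr, div_le_div_iff₀ two_pos hε]
    linarith
  have hcr : c = r * ε := by rw [hr, div_mul_cancel₀ _ hε.ne']
  set X : ℝ := Λ ^ 2 * L₁ ^ 2 * c ^ 4 * K / ε ^ 4 with hX
  have hX' : X = Λ ^ 2 * L₁ ^ 2 * r ^ 4 * K := by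
    rw [hX, hcr]
    field_simp
  have hden : 8 * L₂ * c + 2 * (2 * c + 4 * c ^ 2 / η) * L₁ ^ 2 =
      c * (8 * L₂ + 4 * L₁ ^ 2 + 8 * r * (4 * Λ + 2) * L₁ ^ 2) := by
    rw [hη, hr]
    field_simp
    ring
  have hW : 0 < 8 * L₂ + 4 * L₁ ^ 2 + 8 * r * (4 * Λ + 2) * L₁ ^ 2 := by positivity
  have hT1 : T ≤ 40 * r ^ 2 * (8 * L₂ + 4 * L₁ ^ 2 + 8 * r * (4 * Λ + 2) * L₁ ^ 2) := by
    rw [hτ, hden] at hT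
    set W := 8 * L₂ + 4 * L₁ ^ 2 + 8 * r * (4 * Λ + 2) * L₁ ^ 2
    have e : T * (1 / (c * W) * ε ^ 2 / 20) = T * ε ^ 2 / (20 * c * W) := by
      field_simp
    rw [e, div_le_iff₀ (by positivity)] at hT
    have e2 : 2 * c * (20 * c * W) = (40 * r ^ 2 * W) * ε ^ 2 := by
      rw [hcr]
      ring
    rw [e2] at hT
    exact le_of_mul_le_mul_right hT (by positivity)
  have hr4 : r ^ 2 ≤ 4 * r ^ 4 := by
    have h : 1 ≤ 4 * r ^ 2 := by nlinarith
    nlinarith [mul_le_mul_of_nonneg_left h (sq_nonneg r)]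
  have hr3 : r ^ 3 ≤ 2 * r ^ 4 := by
    have h : 1 ≤ 2 * r := by linarith
    nlinarith [mul_le_mul_of_nonneg_left h (pow_nonneg hr0.le 3)]
  have hΛ2 : 1 ≤ 2.2 * Λ ^ 2 := by nlinarith
  have hΛ3 : 4 * Λ + 2 ≤ 11 * Λ ^ 2 := by nlinarith
  have hY0 : 0 < r ^ 4 * L₁ ^ 2 := by positivity
  have hYX : r ^ 4 * L₁ ^ 2 * Λ ^ 2 ≤ X := by
    rw [hX']
    have : 0 ≤ Λ ^ 2 * L₁ ^ 2 * r ^ 4 := by positivity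
    nlinarith
  have h1 : r ^ 2 * L₁ ^ 2 ≤ 9 * X := by
    have a := mul_le_mul_of_nonneg_right hr4 (sq_nonneg L₁)
    have b := mul_le_mul_of_nonneg_left hΛ2 hY0.le
    linarith
  have h2 : r ^ 3 * (4 * Λ + 2) * L₁ ^ 2 ≤ 22 * X := by
    have a := mul_le_mul_of_nonneg_right hr3 (show 0 ≤ (4 * Λ + 2) * L₁ ^ 2 by positivity)
    have b := mul_le_mul_of_nonneg_left hΛ3 hY0.le
    linarith
  have hX0 : 0 < X := by
    rw [hX']
    positivity
  have hT2 : T ≤ 320 * (r ^ 2 * L₂) + 160 * (r ^ 2 * L₁ ^ 2) +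
      320 * (r ^ 3 * (4 * Λ + 2) * L₁ ^ 2) := hT1.trans (le_of_eq (by ring))
  constructor
  · have h3 : r ^ 2 * L₂ ≤ 9 * X * L₂ := by
      have a : r ^ 2 ≤ 9 * X := le_trans (le_mul_of_one_le_right (sq_nonneg r) hL1sq) h1
      exact mul_le_mul_of_nonneg_right a hL₂.le
    have h4 : 0 ≤ X * L₂ := by positivity
    linarith
  · intro hL
    have h3 : L₂ ≤ L₁ ^ 2 * r := by
      rw [hr, ← mul_div_assoc, le_div_iff₀ hε]
      exact hL
    have h4 : r ^ 2 * L₂ ≤ 22 * X := by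
      have a := mul_le_mul_of_nonneg_left h3 (sq_nonneg r)
      have b : r ^ 3 * 1 * L₁ ^ 2 ≤ r ^ 3 * (4 * Λ + 2) * L₁ ^ 2 := by
        gcongr
        linarith
      linarith
    linarith

/-! ### Convergence of the algorithm -/

variable {m n d k : ℕ}

/-- The algorithm without the break is well defined at all times; an infinite run of steps with
long ascent directions is impossible as the dual value is bounded. -/
lemma exists_rgaReturns [NeZero n] (D : Data m n d) (hc : 0 < cbar D)
    {Retr : Matrix (Fin d) (Fin k) ℝ → Matrix (Fin d) (Fin k) ℝ → Matrix (Fin d) (Fin k) ℝ}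
    (hR : IsRetraction Retr) {L₁ L₂ : ℝ} (hL : IsRetractionConst Retr L₁ L₂)
    {U₀ : Matrix (Fin d) (Fin k) ℝ} (hU₀ : U₀ ∈ stiefel d k)
    (init : ℕ → (Fin m → Fin n → ℝ) × (Fin m → Fin n → ℝ))
    (hinit : ∀ t j, ∑ l, D.w l * (init t).2 l j = 0) {η ε τ : ℝ} (hη : 0 < η) (hε : 0 < ε)
    (hηε : 4 * η ≤ ε) (hηn : 4 * (η * Real.log n) ≤ ε) (hτ : 0 < τ)
    (hτL : τ * (8 * L₂ * cbar D + 8 * cbar D ^ 2 / η * L₁ ^ 2) ≤ 1) :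
    ∃ (T : ℕ) (π : Plan m n) (U : Matrix (Fin d) (Fin k) ℝ),
      RGAReturns D Retr τ η ε init U₀ T π U ∧ IsStationary D ε π U ∧
      (T = 0 ∨ ε ≤ 2 * cbar D ∧ 1 ≤ L₁ ∧ T * (τ * ε ^ 2 / 20) ≤ 2 * cbar D) := by
  classical
  have hiter : ∀ t, ∃ U ∈ stiefel d k, rgaIter D Retr τ η ε init U₀ t = some U := fun t => by
    induction t with
    | zero => exact ⟨U₀, hU₀, rfl⟩
    | succ t ih =>
      obtain ⟨U, hU, hUt⟩ := ih
      obtain ⟨R, hsol, -⟩ := ibpSolver_spec D hc hU hη hε (init t) (hinit t)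
      exact ⟨Retr U (τ • ascentDir D R U),
        hR.mapsTo U hU _ ((tangentSpace U).smul_mem τ (ascentDir_mem D R U)),
        by simp [rgaIter, hUt, hsol]⟩
  choose U hU hUt using hiter
  choose R hsol hRf v hv hdev hRv using fun t =>
    ibpSolver_spec D hc (hU t) hη hε (init t) (hinit t)
  have hsucc : ∀ t, U (t + 1) = Retr (U t) (τ • ascentDir D (R t) (U t)) := fun t => by
    have h := hUt (t + 1)
    simp only [rgaIter, hUt t, hsol t, Option.bind_some, Option.map_some, Option.some.injEq] at h
    exact h.symm
  have hclimb : ∀ N : ℕ, (∀ t < N, ε < ‖ascentDir D (R t) (U t)‖) →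
      dualVal D η (U 0) + N * (τ * ε ^ 2 / 20) ≤ dualVal D η (U N) := fun N => by
    induction N with
    | zero => simp
    | succ N ih =>
      intro hN
      have h1 := ih fun t ht => hN t (ht.trans N.lt_succ_self)
      have h2 := dualVal_ascent D hc hR hL (hU N) hη hε hηε hτ hτL (hRf N) (hv N) (hdev N)
        (hRv N) (hN N N.lt_succ_self)
      rw [← hsucc] at h2
      push_cast
      linarith
  have hbound : ∀ N : ℕ, (∀ t < N, ε < ‖ascentDir D (R t) (U t)‖) →
      N * (τ * ε ^ 2 / 20) ≤ cbar D + ε / 4 := fun N hN => by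
    have h1 := hclimb N hN
    have h2 := dualVal_le_cbar D (hU N) hη
    have h3 := neg_le_dualVal D (hU 0) hη
    linarith
  have hex : ∃ t, ‖ascentDir D (R t) (U t)‖ ≤ ε := by
    by_contra! h
    obtain ⟨N, hN⟩ := exists_nat_gt ((cbar D + ε / 4) / (τ * ε ^ 2 / 20))
    rw [div_lt_iff₀ (by positivity)] at hN
    exact absurd (hbound N fun t _ => h t) (not_le.2 hN)
  have hmin : ∀ t < Nat.find hex, ε < ‖ascentDir D (R t) (U t)‖ := fun t ht =>
    not_le.1 (Nat.find_min hex ht)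
  have hfind := Nat.find_spec hex
  generalize Nat.find hex = T at hmin hfind
  obtain ⟨πs, hπs, hπmin⟩ := exists_isMinOn_objective D (U T)
  refine ⟨T, R T, U T, ⟨hUt T, hsol T, hfind, fun t ht U' π' hU' hπ' => ?_⟩,
    ⟨hRf T, hU T, ?_, πs, hπs, hπmin, ?_⟩, ?_⟩
  · rw [hUt t, Option.some.injEq] at hU'
    subst hU'
    rw [hsol t, Option.some.injEq] at hπ'
    subst hπ'
    exact hmin t ht
  · rw [riemannianGrad_objective]
    exact hfind
  · exact objective_sub_le D hc (hU T) hη hε hηε hηn (hRf T) (hv T) (hdev T) (hRv T) hπs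
  · rcases Nat.eq_zero_or_pos T with h0 | h0
    · exact Or.inl h0
    · have hlong := hmin 0 h0
      have hεc : ε ≤ 2 * cbar D := hlong.le.trans
        (norm_ascentDir_le D (R 0) (hU 0) (wnorm_eq_one_of_feasible D (hRf 0)))
      refine Or.inr ⟨hεc, hL.one_le (hU 0) (ascentDir_mem D (R 0) (U 0))
        (norm_pos_iff.1 (hε.trans hlong)), (hbound T hmin).trans (by linarith)⟩

end

end RPRWB

theorem mainTheorem2 :
    ∃ C : ℝ, 0 < C ∧
    ∀ (d k : ℕ)
      (Retr : Matrix (Fin d) (Fin k) ℝ → Matrix (Fin d) (Fin k) ℝ → Matrix (Fin d) (Fin k) ℝ),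
      1 ≤ k → k ≤ d → RPRWB.IsRetraction Retr →
      (∃ L₁ L₂ : ℝ, RPRWB.IsRetractionConst Retr L₁ L₂) ∧
      ∀ L₁ L₂ : ℝ, RPRWB.IsRetractionConst Retr L₁ L₂ →
      ∀ (m n : ℕ) (D : RPRWB.Data m n d) (ε : ℝ) (U₀ : Matrix (Fin d) (Fin k) ℝ)
        (init : ℕ → (Fin m → Fin n → ℝ) × (Fin m → Fin n → ℝ)),
      2 ≤ n → 0 < RPRWB.cbar D → 0 < ε → U₀ ∈ RPRWB.stiefel d k →
      (∀ t j, ∑ l, D.w l * (init t).2 l j = 0) →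
      ∀ τ η ρ : ℝ,
      τ = 1 / (8 * L₂ * RPRWB.cbar D + 2 * ρ * L₁ ^ 2) →
      η = ε / (4 * Real.log n + 2) →
      ρ = 2 * RPRWB.cbar D + 4 * RPRWB.cbar D ^ 2 / η →
      ∃ (T : ℕ) (π : RPRWB.Plan m n) (U : Matrix (Fin d) (Fin k) ℝ),
        RPRWB.RGAReturns D Retr τ η ε init U₀ T π U ∧
        RPRWB.IsStationary D ε π U ∧
        (T : ℝ) ≤ C * (1 + L₂) *
          (Real.log n ^ 2 * L₁ ^ 2 * RPRWB.cbar D ^ 4 * k / ε ^ 4) ∧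
        (L₂ * ε ≤ L₁ ^ 2 * RPRWB.cbar D →
          (T : ℝ) ≤ C * (Real.log n ^ 2 * L₁ ^ 2 * RPRWB.cbar D ^ 4 * k / ε ^ 4)) := by
  refine ⟨20000, by norm_num, fun d k Retr hk _ hR => ⟨hR.exists_isRetractionConst, ?_⟩⟩
  intro L₁ L₂ hL m n D ε U₀ init hn hc hε hU₀ hinit τ η ρ hτ hη hρ
  have : NeZero n := ⟨by omega⟩
  have hL₁ := hL.pos₁
  have hL₂ := hL.pos₂
  have hlog : 0.69 ≤ Real.log n := by
    have h1 : Real.log 2 ≤ Real.log n :=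
      Real.log_le_log two_pos (by exact_mod_cast hn)
    linarith [Real.log_two_gt_d9]
  have hη0 : 0 < η := by
    rw [hη]
    have : 0 < 4 * Real.log n + 2 := by linarith
    positivity
  have hηmul : η * (4 * Real.log n + 2) = ε := by
    rw [hη, div_mul_cancel₀]
    linarith
  have hηlog := mul_le_mul_of_nonneg_left hlog hη0.le
  have hW : 0 < 8 * L₂ * RPRWB.cbar D + 2 * ρ * L₁ ^ 2 := by
    rw [hρ]
    positivity
  have hτ0 : 0 < τ := by
    rw [hτ]
    positivity
  have hτL : τ * (8 * L₂ * RPRWB.cbar D + 8 * RPRWB.cbar D ^ 2 / η * L₁ ^ 2) ≤ 1 := by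
    rw [hτ, one_div_mul_eq_div, div_le_one hW, hρ]
    have h1 : 0 ≤ 4 * RPRWB.cbar D * L₁ ^ 2 := by positivity
    have e : 8 * RPRWB.cbar D ^ 2 / η = 2 * (4 * RPRWB.cbar D ^ 2 / η) := by ring
    rw [e]
    linarith
  obtain ⟨T, π, U, hret, hstat, hT⟩ := RPRWB.exists_rgaReturns D hc hR hL hU₀ init hinit hη0 hε
    (by linarith) (by linarith) hτ0 hτL
  refine ⟨T, π, U, hret, hstat, ?_⟩
  rcases hT with hT | ⟨hεc, hL1, hT⟩
  · rw [hT, Nat.cast_zero]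
    exact ⟨by positivity, fun _ => by positivity⟩
  · rw [hρ] at hτ
    exact RPRWB.count_le hc hε hεc hL1 hL₂ hlog (by exact_mod_cast hk) hη hτ hT
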